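/- Let $m\ge 2$ and let $(\kappa_n)_{n\ge 1}$ be a sequence of real numbers such that $\kappa_n=0$ for all $n\ge m+1$ and such that $\kappa_n\neq 0$ for at least one $n\ge 2$. For $z\in\mathbb C\setminus\{0\}$ put $$\varphi(z)=\kappa_1+\frac{\kappa_2}{z}+\dots+\frac{\kappa_m}{z^{m-1}},$$ and let $\mathbb C^+=\{z\in\mathbb C:\operatorname{Im}z>0\}$. Let $\Omega_\varphi$ be the connected component of $\{z\in\mathbb C^+:\operatorname{Im}(z+\varphi(z))>0\}$ that contains $\infty$, i.e. the component that contains all points of $\mathbb C^+$ of sufficiently large modulus. Then the following are equivalent. (i) There is a probability measure $\mu$ on $\mathbb R$ with compact support whose sequence of free cumulants is $(\kappa_n)_{n\ge1}$, i.e. such that $$\int_{\mathbb R}x^n\,\mu(dx)=\sum_{\pi\in NC(n)}\ \prod_{V\in\pi}\kappa_{|V|}\qquad\text{for all }n\ge1,$$ where $NC(n)$ is the set of non-crossing partitions of $\{1,\dots,n\}$. (ii) Every Jordan curve (simple arc) contained in $\mathbb C^+\cup\mathbb R$ and joining $0$ and $\infty$ contains a point, other than its endpoints $0$ and $\infty$,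 of the boundary of $\Omega_\varphi$ in $\mathbb C$. -/

import Mathlib

open MeasureTheory

namespace FreeProb

/-- A partition of a finite linearly ordered set is non-crossing if there are no two distinct
blocks `A`, `B` and points `a < b < c < d` with `a, c ∈ A` and `b, d ∈ B`. -/
def NonCrossing {α : Type*} [LinearOrder α] {s : Finset α} (P : Finpartition s) : Prop :=
  ∀ A ∈ P.parts, ∀ B ∈ P.parts, ∀ a ∈ A, ∀ b ∈ B, ∀ c ∈ A, ∀ d ∈ B,
    a < b → b < c → c < d → A = B

instance {α : Type*} [LinearOrder α] {s : Finset α} (P : Finpartition s) :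
    Decidable (NonCrossing P) := by
  unfold NonCrossing; infer_instance

/-- The sum over all non-crossing partitions `π` of an `n`-element linearly ordered set of
`∏_{V ∈ π} κ_{|V|}`. Blocks are nonempty, so `κ 0` never enters. -/
def nonCrossingSum (κ : ℕ → ℝ) (n : ℕ) : ℝ :=
  ∑ P : Finpartition (Finset.range n) with NonCrossing P, ∏ V ∈ P.parts, κ V.card

/-- `(κ n)` for `n ≥ 1` is the sequence of free cumulants of `μ` (a measure on `ℝ` all of whose
moments exist): the free moment-cumulant formula
`∫ x ^ n dμ = ∑_{π ∈ NC(n)} ∏_{V ∈ π} κ_{|V|}` holds for all `n ≥ 1`. The term of the one-block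
partition is `κ n`, so these equations determine `κ n`, `n ≥ 1`, recursively from `μ`. -/
def IsFreeCumulantSeq (μ : Measure ℝ) (κ : ℕ → ℝ) : Prop :=
  ∀ n : ℕ, 1 ≤ n → ∫ x, x ^ n ∂μ = nonCrossingSum κ n

/-- A measure on `ℝ` has compact support if it is carried by a compact set. -/
def CompactlySupported (μ : Measure ℝ) : Prop :=
  ∃ K : Set ℝ, IsCompact K ∧ μ Kᶜ = 0

/-- `φ(z) = κ₁ + κ₂ / z + ⋯ + κ_m / z ^ (m - 1)`. -/
noncomputable def phi (κ : ℕ → ℝ) (m : ℕ) (z : ℂ) : ℂ :=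
  ∑ n ∈ Finset.Icc 1 m, (κ n : ℂ) / z ^ (n - 1)

/-- `{z ∈ ℂ⁺ : Im (z + φ(z)) > 0}`. -/
def region (κ : ℕ → ℝ) (m : ℕ) : Set ℂ :=
  {z | 0 < z.im ∧ 0 < (z + phi κ m z).im}

/-- The connected component of `region κ m` that contains `∞`, that is, which contains all points
of the upper half-plane of sufficiently large modulus. -/
def Omega (κ : ℕ → ℝ) (m : ℕ) : Set ℂ :=
  {z | z ∈ region κ m ∧
    ∃ R : ℝ, ∀ w : ℂ, 0 < w.im → R < ‖w‖ → w ∈ connectedComponentIn (region κ m) z}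

/-- `γ`, restricted to `[0, ∞)`, parametrizes a Jordan curve (a simple arc) in `ℂ⁺ ∪ ℝ` that
joins `0` and `∞`. The value of the parametrization at the endpoint `t = ∞` is the point `∞` of
the extended plane, which is expressed by `γ t → ∞` as `t → ∞`. -/
structure IsJordanCurveZeroInfty (γ : ℝ → ℂ) : Prop where
  continuousOn : ContinuousOn γ (Set.Ici 0)
  injOn : Set.InjOn γ (Set.Ici 0)
  start : γ 0 = 0
  tendsto : Filter.Tendsto γ Filter.atTop (Filter.cocompact ℂ)
  im_nonneg : ∀ t : ℝ, 0 ≤ t → 0 ≤ (γ t).im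

end FreeProb

/-! Write K(z) = z + φ(z) (`kmap`), G for the Cauchy transform of a measure and F = 1/G. Splitting a
non-crossing partition at the successor of its first point gives the functional equation M = 1 + ∑
κ_s (X M)^s for the series M of non-crossing sums (`mk_nonCrossingSum_eq`), and this equation has
only one solution (`powerSeries_unique`). Since G(w) = M(1/w)/w near ∞, having free cumulants κ
amounts to K ∘ F = id on the upper half-plane.

(i) ⇒ (ii): F maps the upper half-plane into Ω, and the identity theorem upgrades K ∘ F = id to F ∘
K = id on Ω (`inv_cauchyTransform_kmap`). As G is small near ∞, a point z of Ω with K(z) large must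
be large itself. A curve that avoids the boundary of Ω runs inside Ω, where it would approach the
pole 0 of K with K large and z small.

(ii) ⇒ (i): if 0 were in the closure of Ω, a chart turning K into c ζ^(-k) would show that a radial
arc ending at 0 lies in Ω, because K only changes by positive factors along it
(`exists_isArcReachable`). Continued to ∞ inside Ω, it gives a Jordan curve that misses the
boundary. So Ω stays away from 0, φ is bounded on Ω, and K is a proper map from Ω to the upper
half-plane. Near ∞ it is one-to-one, hence it is bijective with a holomorphic inverse F
(`exists_right_inverse`). Then 1/F is bounded, has non-positive imaginary part and behaves like 1/w
at ∞; Poisson's formula and weak compactness make it the Cauchy transform of a compactly supported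
probability measure (`exists_cauchyTransform_eq`). -/

namespace FreeProb

/-! ### Decomposition of non-crossing partitions at the successor of the first point -/

open Finset

/-- The sum over the non-crossing partitions of `s` of the product of a weight over the blocks. -/
def ncSum (w : Finset ℕ → ℝ) (s : Finset ℕ) : ℝ :=
  ∑ P : Finpartition s with NonCrossing P, ∏ V ∈ P.parts, w V

lemma mem_parts_restrict {s t : Finset ℕ} (P : Finpartition s) (h : t ≤ s) {V : Finset ℕ} :
    V ∈ (P.restrict h).parts ↔ V.Nonempty ∧ ∃ B ∈ P.parts, B ∩ t = V := by
  simp [Finpartition.restrict, Finset.nonempty_iff_ne_empty]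

lemma NonCrossing.restrict {s t : Finset ℕ} {P : Finpartition s} (hP : NonCrossing P)
    (h : t ≤ s) : NonCrossing (P.restrict h) := by
  intro A hA B hB a ha b hb c hc d hd hab hbc hcd
  obtain ⟨-, A', hA', rfl⟩ := (mem_parts_restrict P h).1 hA
  obtain ⟨-, B', hB', rfl⟩ := (mem_parts_restrict P h).1 hB
  simp only [mem_inter] at ha hb hc hd
  rw [hP A' hA' B' hB' a ha.1 b hb.1 c hc.1 d hd.1 hab hbc hcd]

/-- Glue a partition of `(a, v)` and a partition of `[v, b)`, adding `a` to the block of `v`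
(or, if `v = b`, as a singleton). -/
def glue {a v b : ℕ} (hav : a < v) (hvb : v ≤ b) (Q : Finpartition (Ico (a + 1) v))
    (R : Finpartition (Ico v b)) : Finpartition (Ico a b) :=
  Finpartition.ofExistsUnique
    (Q.parts ∪ insert (insert a (R.part v)) (R.parts.erase (R.part v)))
    (by
      intro V hV x hx
      simp only [mem_union, mem_insert, mem_erase] at hV
      rcases hV with hV | rfl | ⟨-, hV⟩
      · have := mem_Ico.1 (Q.subset hV hx)
        exact mem_Ico.2 (by omega)
      · rcases mem_insert.1 hx with rfl | hx
        · exact mem_Ico.2 (by omega)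
        · have := mem_Ico.1 (R.part_subset v hx)
          exact mem_Ico.2 (by omega)
      · have := mem_Ico.1 (R.subset hV hx)
        exact mem_Ico.2 (by omega))
    (by
      have hQ : ∀ V ∈ Q.parts, ∀ x ∈ V, a < x ∧ x < v := fun V hV x hx => by
        have := mem_Ico.1 (Q.subset hV hx)
        omega
      have hR : ∀ V ∈ R.parts, ∀ x ∈ V, v ≤ x := fun V hV x hx =>
        (mem_Ico.1 (R.subset hV hx)).1
      have hR' : ∀ x ∈ R.part v, v ≤ x := fun x hx => (mem_Ico.1 (R.part_subset v hx)).1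
      intro x hx
      rw [mem_Ico] at hx
      simp only [mem_union, mem_insert, mem_erase]
      rcases eq_or_lt_of_le hx.1 with rfl | hax
      · refine ⟨insert a (R.part v), ⟨Or.inr (Or.inl rfl), mem_insert_self _ _⟩, ?_⟩
        rintro V ⟨hV | rfl | ⟨-, hV⟩, hxV⟩
        · exact absurd (hQ V hV _ hxV).1 (lt_irrefl _)
        · rfl
        · have := hR V hV _ hxV
          omega
      · rcases lt_or_ge x v with hxv | hxv
        · obtain ⟨V, ⟨hV, hxV⟩, huniq⟩ := Q.existsUnique_mem (a := x) (mem_Ico.2 (by omega))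
          refine ⟨V, ⟨Or.inl hV, hxV⟩, ?_⟩
          rintro W ⟨hW | rfl | ⟨-, hW⟩, hxW⟩
          · exact huniq W ⟨hW, hxW⟩
          · rcases mem_insert.1 hxW with rfl | h
            · omega
            · have := hR' _ h
              omega
          · have := hR W hW _ hxW
            omega
        · have hxR : x ∈ Ico v b := mem_Ico.2 (by omega)
          have hx0 : x ∈ R.part x := R.mem_part_self.2 hxR
          by_cases hxp : x ∈ R.part v
          · refine ⟨insert a (R.part v), ⟨Or.inr (Or.inl rfl), mem_insert_of_mem hxp⟩, ?_⟩
            rintro W ⟨hW | rfl | ⟨hne, hW⟩, hxW⟩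
            · have := hQ W hW _ hxW
              omega
            · rfl
            · exact absurd (R.eq_of_mem_parts hW
                (R.part_mem.2 (R.part_nonempty.1 ⟨x, hxp⟩)) hxW hxp) hne
          · refine ⟨R.part x, ⟨Or.inr (Or.inr ⟨fun h => hxp (h ▸ hx0), R.part_mem.2 hxR⟩),
              hx0⟩, ?_⟩
            rintro W ⟨hW | rfl | ⟨hne, hW⟩, hxW⟩
            · have := hQ W hW _ hxW
              omega
            · rcases mem_insert.1 hxW with rfl | h
              · omega
              · exact absurd h hxp
            · exact R.eq_of_mem_parts hW (R.part_mem.2 hxR) hxW hx0)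
    (by
      simp only [mem_union, mem_insert, mem_erase, not_or, not_and]
      exact ⟨Q.empty_notMem_parts, (insert_ne_empty _ _).symm,
        fun _ => R.empty_notMem_parts⟩)

section Glue

variable {a v b : ℕ} (hav : a < v) (hvb : v ≤ b) (Q : Finpartition (Ico (a + 1) v))
  (R : Finpartition (Ico v b))

lemma glue_parts : (glue hav hvb Q R).parts =
    Q.parts ∪ insert (insert a (R.part v)) (R.parts.erase (R.part v)) := rfl

lemma glue_part_left : (glue hav hvb Q R).part a = insert a (R.part v) :=
  Finpartition.part_eq_of_mem _ (by simp [glue_parts]) (mem_insert_self _ _)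

lemma prod_glue_parts (w : Finset ℕ → ℝ) :
    ∏ V ∈ (glue hav hvb Q R).parts, w V =
      (∏ V ∈ Q.parts, w V) *
        (w (insert a (R.part v)) * ∏ V ∈ R.parts.erase (R.part v), w V) := by
  rw [glue_parts, prod_union, prod_insert]
  · intro h
    have := mem_Ico.1 (R.subset (mem_of_mem_erase h) (mem_insert_self a _))
    omega
  · rw [disjoint_left]
    intro V hV hV'
    rcases mem_insert.1 hV' with rfl | hV'
    · have := mem_Ico.1 (Q.subset hV (mem_insert_self a _))
      omega
    · obtain ⟨x, hx⟩ := Q.nonempty_of_mem_parts hV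
      have h1 := mem_Ico.1 (Q.subset hV hx)
      have h2 := mem_Ico.1 (R.subset (mem_of_mem_erase hV') hx)
      omega

lemma glue_nonCrossing (hQ : NonCrossing Q) (hR : NonCrossing R) :
    NonCrossing (glue hav hvb Q R) := by
  intro A hA B hB x hx y hy z hz t ht hxy hyz hzt
  have bQ : ∀ V ∈ Q.parts, ∀ x ∈ V, a < x ∧ x < v := fun V hV x hx => by
    have := mem_Ico.1 (Q.subset hV hx)
    omega
  have bR : ∀ V ∈ R.parts, ∀ x ∈ V, v ≤ x := fun V hV x hx =>
    (mem_Ico.1 (R.subset hV hx)).1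
  have bR' : ∀ x ∈ R.part v, v ≤ x := fun x hx => (mem_Ico.1 (R.part_subset v hx)).1
  have bmem : ∀ x ∈ R.part v, R.part v ∈ R.parts := fun x hx =>
    R.part_mem.2 (R.part_nonempty.1 ⟨x, hx⟩)
  have bself : ∀ x ∈ R.part v, v ∈ R.part v := fun x hx =>
    R.mem_part_self.2 (R.part_nonempty.1 ⟨x, hx⟩)
  simp only [glue_parts, mem_union, mem_insert, mem_erase] at hA hB
  rcases hA with hA | rfl | ⟨hAne, hA⟩ <;> rcases hB with hB | rfl | ⟨hBne, hB⟩
  · exact hQ A hA B hB x hx y hy z hz t ht hxy hyz hzt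
  · have h1 := bQ A hA x hx
    have h2 := bQ A hA z hz
    rcases mem_insert.1 hy with rfl | hy
    · omega
    · have := bR' _ hy
      omega
  · have h2 := bQ A hA z hz
    have := bR B hB _ hy
    omega
  · have h1 := bQ B hB y hy
    have h2 := bQ B hB t ht
    rcases mem_insert.1 hz with rfl | hz
    · omega
    · have := bR' _ hz
      omega
  · rfl
  -- A crossing that involves the enlarged block gives one in `R`: its first point, possibly `a`,
  -- can be replaced by `v`, since `y` lies in another block and so `v < y`.
  · exfalso
    have hzv : z ∈ R.part v := by
      rcases mem_insert.1 hz with rfl | hz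
      · have := bR B hB y hy
        omega
      · exact hz
    have hvv := bself z hzv
    have hvy : v < y := lt_of_le_of_ne (bR B hB y hy) (by
      rintro rfl
      exact hBne (R.eq_of_mem_parts hB (bmem z hzv) hy hvv))
    exact hBne (hR _ (bmem z hzv) B hB v hvv y hy z hzv t ht hvy hyz hzt).symm
  · have h1 := bQ B hB t ht
    have h2 := bR A hA _ hx
    omega
  · exfalso
    have hvx := bR A hA x hx
    have hy' : y ∈ R.part v := by
      rcases mem_insert.1 hy with rfl | hy
      · omega
      · exact hy
    have ht' : t ∈ R.part v := by
      rcases mem_insert.1 ht with rfl | ht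
      · omega
      · exact ht
    exact hAne (hR A hA _ (bmem y hy') x hx y hy' z hz t ht' hxy hyz hzt)
  · exact hR A hA B hB x hx y hy z hz t ht hxy hyz hzt

end Glue

/-- `v` is the successor of `a` in its block of `P`, or `v = b` and `{a}` is a block. -/
def IsNext {a b : ℕ} (P : Finpartition (Ico a b)) (v : ℕ) : Prop :=
  P.part a ⊆ insert a (Ico v b) ∧ (v < b → v ∈ P.part a)

/-- The witness is the least element other than `a` in the block of `a`, or `b` if there is none.
Uniqueness lets the sum over partitions be split according to `v`. -/
lemma existsUnique_isNext {a b : ℕ} (P : Finpartition (Ico a b)) (hab : a < b) :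
    ∃! v, v ∈ Ioc a b ∧ IsNext P v := by
  have ha : a ∈ Ico a b := mem_Ico.2 (by omega)
  by_cases h : ((P.part a).erase a).Nonempty
  · set u := ((P.part a).erase a).min' h with hu
    have hmem := mem_erase.1 (min'_mem _ h)
    rw [← hu] at hmem
    have h1 := mem_Ico.1 (P.part_subset a hmem.2)
    refine ⟨u, ⟨mem_Ioc.2 (by omega), fun x hx => ?_, fun _ => hmem.2⟩, ?_⟩
    · by_cases hxa : x = a
      · simp [hxa]
      · refine mem_insert_of_mem (mem_Ico.2 ⟨min'_le _ _ (mem_erase.2 ⟨hxa, hx⟩), ?_⟩)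
        exact (mem_Ico.1 (P.part_subset a hx)).2
    · rintro v ⟨hv, hv1, hv2⟩
      rw [mem_Ioc] at hv
      have h3 := hv1 hmem.2
      rw [mem_insert, mem_Ico] at h3
      have hvu : v ≤ u := by omega
      refine le_antisymm hvu (min'_le _ _ (mem_erase.2 ⟨by omega, hv2 (by omega)⟩))
  · rw [not_nonempty_iff_eq_empty] at h
    have hp : ∀ x ∈ P.part a, x = a := fun x hx => by
      by_contra hxa
      have : x ∈ (P.part a).erase a := mem_erase.2 ⟨hxa, hx⟩
      simp [h] at this
    refine ⟨b, ⟨mem_Ioc.2 (by omega), fun x hx => by simp [hp x hx], by omega⟩, ?_⟩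
    rintro v ⟨hv, hv1, hv2⟩
    rw [mem_Ioc] at hv
    by_contra hvb
    have := hp v (hv2 (by omega))
    omega

section Unglue

variable {a v b : ℕ}

lemma Ico_succ_le (hvb : v ≤ b) : Ico (a + 1) v ≤ Ico a b :=
  Ico_subset_Ico (by omega) hvb

lemma Ico_right_le (hav : a < v) : Ico v b ≤ Ico a b :=
  Ico_subset_Ico hav.le le_rfl

lemma glue_isNext (hav : a < v) (hvb : v ≤ b) (Q : Finpartition (Ico (a + 1) v))
    (R : Finpartition (Ico v b)) : IsNext (glue hav hvb Q R) v := by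
  rw [IsNext, glue_part_left]
  exact ⟨insert_subset_insert _ (R.part_subset v),
    fun h => mem_insert_of_mem (R.mem_part_self.2 (mem_Ico.2 ⟨le_rfl, h⟩))⟩

lemma glue_restrict_left (hav : a < v) (hvb : v ≤ b) (Q : Finpartition (Ico (a + 1) v))
    (R : Finpartition (Ico v b)) :
    (glue hav hvb Q R).restrict (Ico_succ_le hvb) = Q := by
  have hsub : ∀ V ∈ Q.parts, V ∩ Ico (a + 1) v = V := fun V hV =>
    inter_eq_left.2 (Q.subset hV)
  ext V
  rw [mem_parts_restrict]
  constructor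
  · rintro ⟨⟨x, hx⟩, B, hB, rfl⟩
    simp only [glue_parts, mem_union, mem_insert, mem_erase] at hB
    rw [mem_inter, mem_Ico] at hx
    rcases hB with hB | rfl | ⟨-, hB⟩
    · rwa [hsub B hB]
    · rcases mem_insert.1 hx.1 with rfl | h
      · omega
      · have := mem_Ico.1 (R.part_subset v h)
        omega
    · have := mem_Ico.1 (R.subset hB hx.1)
      omega
  · exact fun hV => ⟨Q.nonempty_of_mem_parts hV, V, by simp [glue_parts, hV], hsub V hV⟩

lemma glue_restrict_right (hav : a < v) (hvb : v ≤ b) (Q : Finpartition (Ico (a + 1) v))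
    (R : Finpartition (Ico v b)) :
    (glue hav hvb Q R).restrict (Ico_right_le hav) = R := by
  have hsub : ∀ V ∈ R.parts, V ∩ Ico v b = V := fun V hV =>
    inter_eq_left.2 (R.subset hV)
  have hins : insert a (R.part v) ∩ Ico v b = R.part v := by
    rw [insert_inter_of_notMem (by simp [hav]), inter_eq_left]
    exact R.part_subset v
  ext V
  rw [mem_parts_restrict]
  constructor
  · rintro ⟨⟨x, hx⟩, B, hB, rfl⟩
    simp only [glue_parts, mem_union, mem_insert, mem_erase] at hB
    rcases hB with hB | rfl | ⟨-, hB⟩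
    · rw [mem_inter, mem_Ico] at hx
      have := mem_Ico.1 (Q.subset hB hx.1)
      omega
    · rw [hins] at hx ⊢
      exact R.part_mem.2 (R.part_nonempty.1 ⟨x, hx⟩)
    · rwa [hsub B hB]
  · intro hV
    refine ⟨R.nonempty_of_mem_parts hV, ?_⟩
    by_cases h : V = R.part v
    · exact ⟨insert a (R.part v), by simp [glue_parts], by rw [hins, h]⟩
    · exact ⟨V, by simp [glue_parts, hV, h], hsub V hV⟩

/-- Non-crossing is what makes cutting at `v` lossless: a block other than that of `a` with points
on both sides of `v` would cross the pair `a`, `v`. -/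
lemma glue_restrict_restrict (hav : a < v) (hvb : v ≤ b) {P : Finpartition (Ico a b)}
    (hP : NonCrossing P) (hv : IsNext P v) :
    glue hav hvb (P.restrict (Ico_succ_le hvb)) (P.restrict (Ico_right_le hav)) = P := by
  have ha : a ∈ Ico a b := mem_Ico.2 (by omega)
  have haa : a ∈ P.part a := P.mem_part_self.2 ha
  have hpa : P.part a ∈ P.parts := P.part_mem.2 ha
  have hpart : (P.restrict (Ico_right_le hav) : Finpartition (Ico v b)).part v =
      (P.part a).erase a := by
    rcases hvb.lt_or_eq with hlt | rfl
    · have hva := hv.2 hlt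
      refine Finpartition.part_eq_of_mem _ ((mem_parts_restrict _ _).2
        ⟨⟨v, mem_erase.2 ⟨by omega, hva⟩⟩, _, hpa, ?_⟩) (mem_erase.2 ⟨by omega, hva⟩)
      ext x
      rw [mem_inter, mem_erase]
      constructor
      · rintro ⟨h1, h2⟩
        rw [mem_Ico] at h2
        exact ⟨by omega, h1⟩
      · rintro ⟨h1, h2⟩
        exact ⟨h2, (mem_insert.1 (hv.1 h2)).resolve_left h1⟩
    · rw [Finpartition.part_eq_empty _ |>.2 (by simp)]
      symm
      rw [erase_eq_empty_iff]
      right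
      refine subset_antisymm (by simpa using hv.1) (by simpa using haa)
  have hdich : ∀ B ∈ P.parts, B ≠ P.part a → B ⊆ Ico (a + 1) v ∨ B ⊆ Ico v b := by
    intro B hB hne
    have hBa : a ∉ B := fun h => hne (P.eq_of_mem_parts hB hpa h haa)
    have hbd : ∀ x ∈ B, a < x ∧ x < b := fun x hx => by
      have := mem_Ico.1 (P.subset hB hx)
      have : x ≠ a := fun h => hBa (h ▸ hx)
      omega
    by_contra hcon
    simp only [not_or, not_subset, mem_Ico] at hcon
    obtain ⟨⟨y, hy, hy'⟩, ⟨x, hx, hx'⟩⟩ := hcon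
    have h1 := hbd x hx
    have h2 := hbd y hy
    have hva := hv.2 (by omega)
    have hyv : y ≠ v := fun h => hne (P.eq_of_mem_parts hB hpa (h ▸ hy) hva)
    exact hne (hP _ hpa B hB a haa x hx v hva y hy (by omega) (by omega) (by omega)).symm
  ext V
  rw [glue_parts, hpart, insert_erase haa, mem_union, mem_insert, mem_erase,
    mem_parts_restrict, mem_parts_restrict]
  constructor
  · rintro (⟨⟨x, hx⟩, B, hB, rfl⟩ | rfl | ⟨hne, ⟨x, hx⟩, B, hB, rfl⟩)
    · rw [mem_inter, mem_Ico] at hx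
      have hBne : B ≠ P.part a := by
        rintro rfl
        have := hv.1 hx.1
        rw [mem_insert, mem_Ico] at this
        omega
      rcases hdich B hB hBne with h | h
      · rwa [inter_eq_left.2 h]
      · have := mem_Ico.1 (h hx.1)
        omega
    · exact hpa
    · rw [mem_inter, mem_Ico] at hx
      have hBne : B ≠ P.part a := by
        rintro rfl
        apply hne
        ext y
        rw [mem_inter, mem_erase]
        constructor
        · rintro ⟨h1, h2⟩
          rw [mem_Ico] at h2
          exact ⟨by omega, h1⟩
        · rintro ⟨h1, h2⟩
          exact ⟨h2, (mem_insert.1 (hv.1 h2)).resolve_left h1⟩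
      rcases hdich B hB hBne with h | h
      · have := mem_Ico.1 (h hx.1)
        omega
      · rwa [inter_eq_left.2 h]
  · intro hV
    by_cases hVa : V = P.part a
    · exact Or.inr (Or.inl hVa)
    · have hne := P.nonempty_of_mem_parts hV
      rcases hdich V hV hVa with h | h
      · exact Or.inl ⟨hne, V, hV, inter_eq_left.2 h⟩
      · refine Or.inr (Or.inr ⟨?_, hne, V, hV, inter_eq_left.2 h⟩)
        rintro rfl
        obtain ⟨x, hx⟩ := hne
        exact hVa (P.eq_of_mem_parts hV hpa hx (mem_of_mem_erase hx))

end Unglue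

-- Sorting by the successor `v` of `a`, the points strictly between `a` and `v` carry an independent
-- non-crossing partition, and removing `a` leaves an arbitrary one on `[v, b)`. The index `v = b`
-- accounts for the singleton `{a}`.
open scoped Classical in
lemma ncSum_Ico (w : Finset ℕ → ℝ) {a b : ℕ} (hab : a < b) :
    ncSum w (Ico a b) = ∑ v ∈ Ioc a b, ncSum w (Ico (a + 1) v) *
      ∑ R : Finpartition (Ico v b) with NonCrossing R,
        w (insert a (R.part v)) * ∏ V ∈ R.parts.erase (R.part v), w V := by
  have h1 : ∀ P : Finpartition (Ico a b), ∏ V ∈ P.parts, w V =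
      ∑ v ∈ Ioc a b, if IsNext P v then ∏ V ∈ P.parts, w V else 0 := by
    intro P
    obtain ⟨v, ⟨hv, hv'⟩, huniq⟩ := existsUnique_isNext P hab
    rw [sum_eq_single_of_mem v hv, if_pos hv']
    intro u hu huv
    rw [if_neg]
    exact fun h => huv (huniq u ⟨hu, h⟩)
  rw [ncSum, sum_congr rfl (fun P _ => h1 P), sum_comm]
  refine sum_congr rfl fun v hv => ?_
  rw [mem_Ioc] at hv
  obtain ⟨hav, hvb⟩ := hv
  rw [ncSum, sum_mul_sum, ← sum_product', ← sum_filter, filter_filter]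
  refine sum_bij' (fun P _ => (P.restrict (Ico_succ_le hvb), P.restrict (Ico_right_le hav)))
    (fun QR _ => glue hav hvb QR.1 QR.2) ?_ ?_ ?_ ?_ ?_
  · intro P hP
    simp only [mem_filter, mem_univ, true_and, mem_product] at hP ⊢
    exact ⟨hP.1.restrict _, hP.1.restrict _⟩
  · intro QR h
    simp only [mem_filter, mem_univ, true_and, mem_product] at h ⊢
    exact ⟨glue_nonCrossing hav hvb _ _ h.1 h.2, glue_isNext hav hvb _ _⟩
  · intro P hP
    simp only [mem_filter, mem_univ, true_and] at hP
    exact glue_restrict_restrict hav hvb hP.1 hP.2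
  · intro QR _
    exact Prod.ext (glue_restrict_left hav hvb _ _) (glue_restrict_right hav hvb _ _)
  · intro P hP
    simp only [mem_filter, mem_univ, true_and] at hP
    rw [← prod_glue_parts hav hvb, glue_restrict_restrict hav hvb hP.1 hP.2]

lemma ncSum_congr {w w' : Finset ℕ → ℝ} {s : Finset ℕ} (h : ∀ V ⊆ s, w V = w' V) :
    ncSum w s = ncSum w' s :=
  sum_congr rfl fun P _ => prod_congr rfl fun V hV => h V (P.subset hV)

lemma ncSum_empty (w : Finset ℕ → ℝ) : ncSum w ∅ = 1 := by
  have : (univ.filter fun P : Finpartition (∅ : Finset ℕ) => NonCrossing P) =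
      {Finpartition.empty (Finset ℕ)} := by
    ext P
    simp only [mem_filter, mem_univ, true_and, mem_singleton]
    refine ⟨fun _ => Subsingleton.elim (α := Finpartition (⊥ : Finset ℕ)) _ _, fun h => ?_⟩
    subst h
    intro A hA
    simp [Finpartition.empty] at hA
  rw [ncSum, this]
  simp [Finpartition.empty]

/-- The weight `κ |V|`, shifted to `κ (|V| + j)` on the block of `a`. -/
def shiftWeight (κ : ℕ → ℝ) (j a : ℕ) (V : Finset ℕ) : ℝ :=
  κ (if a ∈ V then V.card + j else V.card)

lemma sum_glue_Ico_self (w : Finset ℕ → ℝ) (a b : ℕ) :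
    ∑ R : Finpartition (Ico b b) with NonCrossing R,
      w (insert a (R.part b)) * ∏ V ∈ R.parts.erase (R.part b), w V = w {a} := by
  have h1 : ∀ R : Finpartition (Ico b b),
      w (insert a (R.part b)) * ∏ V ∈ R.parts.erase (R.part b), w V =
        w {a} * ∏ V ∈ R.parts, w V := fun R => by
    -- `b` is outside the empty interval, so its part has the default value `∅` and the block of `a`
    -- is `{a}`.
    have hb : R.part b = ∅ := R.part_eq_empty.2 (by simp)
    rw [hb, erase_eq_of_notMem R.empty_notMem_parts, insert_empty_eq]
  rw [sum_congr rfl fun R _ => h1 R, ← mul_sum]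
  have h2 := ncSum_empty w
  rw [← Ico_self b, ncSum] at h2
  rw [h2, mul_one]

/-- Removing `a` shortens its block by one, which raising the shift from `j` to `j + 1` compensates.
The shifted sums therefore satisfy a closed recursion. -/
lemma ncSum_shiftWeight_Ico (κ : ℕ → ℝ) (j : ℕ) {a b : ℕ} (hab : a < b) :
    ncSum (shiftWeight κ j a) (Ico a b) =
      κ (1 + j) * ncSum (fun V => κ V.card) (Ico (a + 1) b) +
      ∑ v ∈ Ioo a b, ncSum (fun V => κ V.card) (Ico (a + 1) v) *
        ncSum (shiftWeight κ (j + 1) v) (Ico v b) := by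
  have hleft : ∀ v, ncSum (shiftWeight κ j a) (Ico (a + 1) v) =
      ncSum (fun V => κ V.card) (Ico (a + 1) v) := fun v => ncSum_congr fun V hV => by
    rw [shiftWeight, if_neg]
    intro h
    have := mem_Ico.1 (hV h)
    omega
  have hsplit : Ioc a b = insert b (Ioo a b) := (Ioo_insert_right hab).symm
  rw [ncSum_Ico _ hab, hsplit, sum_insert (by simp)]
  simp only [hleft]
  congr 1
  · rw [mul_comm]
    congr 1
    rw [sum_glue_Ico_self]
    simp [shiftWeight]
  · refine sum_congr rfl fun v hv => ?_
    rw [mem_Ioo] at hv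
    congr 1
    refine sum_congr rfl fun R _ => ?_
    have hvR : v ∈ Ico v b := mem_Ico.2 (by omega)
    have hvv := R.mem_part_self.2 hvR
    have hnotin : ∀ V ∈ R.parts, a ∉ V := fun V hV h => by
      have := mem_Ico.1 (R.subset hV h)
      omega
    rw [← mul_prod_erase R.parts _ (R.part_mem.2 hvR)]
    congr 1
    · rw [shiftWeight, shiftWeight, if_pos (mem_insert_self _ _), if_pos hvv,
        card_insert_of_notMem (hnotin _ (R.part_mem.2 hvR))]
      congr 1
      ring
    · refine prod_congr rfl fun V hV => ?_
      rw [mem_erase] at hV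
      rw [shiftWeight, shiftWeight, if_neg (hnotin V hV.2), if_neg]
      exact fun h => hV.1 (R.part_eq_of_mem hV.2 h).symm

end FreeProb

/-! ### The functional equation of the generating series -/

namespace FreeProb

open Finset
open PowerSeries hiding mk

/-- The sum over the non-crossing partitions of an interval of length `n` of `∏ κ |V|`, where the
first block contributes `κ (|V| + j)` instead. -/
def shiftedSum (κ : ℕ → ℝ) (j n : ℕ) : ℝ := ncSum (shiftWeight κ j 0) (Ico 0 n)

lemma ncSum_shiftWeight_zero (κ : ℕ → ℝ) (a : ℕ) (s : Finset ℕ) :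
    ncSum (shiftWeight κ 0 a) s = ncSum (fun V => κ V.card) s :=
  ncSum_congr fun V _ => by simp [shiftWeight]

/-- Here the unshifted factors are written with shift `0` as well, so that one induction on the
length, for all shifts together, yields translation invariance. -/
lemma ncSum_shiftWeight_Ico_add (κ : ℕ → ℝ) (j a n : ℕ) :
    ncSum (shiftWeight κ j a) (Ico a (a + (n + 1))) =
      κ (1 + j) * ncSum (shiftWeight κ 0 (a + 1)) (Ico (a + 1) (a + 1 + n)) +
      ∑ i ∈ range n, ncSum (shiftWeight κ 0 (a + 1)) (Ico (a + 1) (a + 1 + i)) *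
        ncSum (shiftWeight κ (j + 1) (a + 1 + i)) (Ico (a + 1 + i) (a + 1 + i + (n - i))) := by
  rw [ncSum_shiftWeight_Ico κ j (by omega : a < a + (n + 1))]
  simp only [ncSum_shiftWeight_zero]
  have h1 : a + (n + 1) = a + 1 + n := by omega
  have h2 : Ioo a (a + (n + 1)) = Ico (a + 1) (a + 1 + n) := by
    ext x
    simp only [mem_Ioo, mem_Ico]
    omega
  rw [h2, h1, sum_Ico_eq_sum_range]
  congr 1
  simp only [add_tsub_cancel_left]
  refine sum_congr rfl fun i hi => ?_
  rw [mem_range] at hi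
  rw [show a + 1 + i + (n - i) = a + 1 + n by omega]

lemma ncSum_shiftWeight_translate (κ : ℕ → ℝ) (n : ℕ) : ∀ j a : ℕ,
    ncSum (shiftWeight κ j a) (Ico a (a + n)) = shiftedSum κ j n := by
  induction n using Nat.strong_induction_on with
  | _ n ih =>
    intro j a
    rcases n with _ | n
    · simp [shiftedSum, ncSum_empty]
    · have h0 := ncSum_shiftWeight_Ico_add κ j 0 n
      rw [Nat.zero_add (n + 1)] at h0
      rw [shiftedSum, h0, ncSum_shiftWeight_Ico_add, ih n (by omega), ih n (by omega)]
      congr 1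
      refine sum_congr rfl fun i hi => ?_
      rw [mem_range] at hi
      rw [ih i (by omega), ih i (by omega), ih (n - i) (by omega), ih (n - i) (by omega)]

lemma shiftedSum_zero_right (κ : ℕ → ℝ) (j : ℕ) : shiftedSum κ j 0 = 1 := by
  simp [shiftedSum, ncSum_empty]

lemma shiftedSum_succ (κ : ℕ → ℝ) (j n : ℕ) :
    shiftedSum κ j (n + 1) = κ (1 + j) * shiftedSum κ 0 n +
      ∑ i ∈ range n, shiftedSum κ 0 i * shiftedSum κ (j + 1) (n - i) := by
  have h0 := ncSum_shiftWeight_Ico_add κ j 0 n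
  rw [Nat.zero_add (n + 1)] at h0
  rw [shiftedSum, h0]
  simp only [ncSum_shiftWeight_translate]

lemma shiftedSum_zero_left (κ : ℕ → ℝ) (n : ℕ) : shiftedSum κ 0 n = nonCrossingSum κ n := by
  rw [shiftedSum, ncSum_shiftWeight_zero, ← range_eq_Ico]
  rfl

lemma nonCrossingSum_zero (κ : ℕ → ℝ) : nonCrossingSum κ 0 = 1 := by
  rw [← shiftedSum_zero_left, shiftedSum_zero_right]

/-- The first block is nonempty, so its weight is a cumulant of index at least `j + 1 > m`. -/
lemma shiftedSum_eq_zero {κ : ℕ → ℝ} {m : ℕ} (hκ : ∀ n, m + 1 ≤ n → κ n = 0) (n : ℕ) :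
    ∀ j, m ≤ j → shiftedSum κ j (n + 1) = 0 := by
  induction n using Nat.strong_induction_on with
  | _ n ih =>
    intro j hj
    rw [shiftedSum_succ, hκ _ (by omega), zero_mul, zero_add]
    refine sum_eq_zero fun i hi => ?_
    rw [mem_range] at hi
    have h := ih (n - i - 1) (by omega) (j + 1) (by omega)
    rw [show n - i - 1 + 1 = n - i by omega] at h
    rw [h, mul_zero]

/-- This is `shiftedSum_succ` for generating series; subtracting `1` from the last factor accounts
for the index `i = n` missing from the convolution there. -/
lemma mk_shiftedSum_sub_one (κ : ℕ → ℝ) (j : ℕ) :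
    (PowerSeries.mk (shiftedSum κ j) - 1 : ℝ⟦X⟧) =
      C (κ (1 + j)) * (X * PowerSeries.mk (shiftedSum κ 0)) +
      X * PowerSeries.mk (shiftedSum κ 0) * (PowerSeries.mk (shiftedSum κ (j + 1)) - 1) := by
  have h : C (κ (1 + j)) * (X * PowerSeries.mk (shiftedSum κ 0)) +
      X * PowerSeries.mk (shiftedSum κ 0) * (PowerSeries.mk (shiftedSum κ (j + 1)) - 1) =
      X * (C (κ (1 + j)) * PowerSeries.mk (shiftedSum κ 0) +
        PowerSeries.mk (shiftedSum κ 0) * (PowerSeries.mk (shiftedSum κ (j + 1)) - 1)) := by ring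
  rw [h]
  ext n
  rcases n with _ | n
  · simp [shiftedSum_zero_right]
  · rw [coeff_succ_X_mul, map_sub, coeff_mk, coeff_one, if_neg (by omega), sub_zero,
      shiftedSum_succ, map_add, coeff_C_mul, coeff_mk, coeff_mul,
      Nat.sum_antidiagonal_eq_sum_range_succ_mk, sum_range_succ]
    simp only [coeff_mk, map_sub, Nat.sub_self, coeff_one, if_true, shiftedSum_zero_right, sub_self,
      mul_zero, add_zero]
    congr 1
    refine sum_congr rfl fun i hi => ?_
    rw [mem_range] at hi
    rw [if_neg (by omega), sub_zero]

/-- The functional equation of the moment generating series. -/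
lemma mk_nonCrossingSum_eq {κ : ℕ → ℝ} {m : ℕ} (hκ : ∀ n, m + 1 ≤ n → κ n = 0) :
    (PowerSeries.mk (nonCrossingSum κ) : ℝ⟦X⟧) =
      1 + ∑ s ∈ Icc 1 m, C (κ s) * (X * PowerSeries.mk (nonCrossingSum κ)) ^ s := by
  have hM : (PowerSeries.mk (nonCrossingSum κ) : ℝ⟦X⟧) = PowerSeries.mk (shiftedSum κ 0) := by
    ext n
    simp [shiftedSum_zero_left]
  rw [hM]
  -- Iterating `mk_shiftedSum_sub_one` produces one term of the sum at a time. At `i = m` the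
  -- remainder vanishes, because the series with shift `m` is `1`.
  have key : ∀ i : ℕ, (PowerSeries.mk (shiftedSum κ 0) - 1 : ℝ⟦X⟧) =
      ∑ s ∈ Icc 1 i, C (κ s) * (X * PowerSeries.mk (shiftedSum κ 0)) ^ s +
        (X * PowerSeries.mk (shiftedSum κ 0)) ^ i * (PowerSeries.mk (shiftedSum κ i) - 1) := by
    intro i
    induction i with
    | zero => simp
    | succ i ih =>
      rw [ih, sum_Icc_succ_top (by omega), mk_shiftedSum_sub_one κ i, add_comm 1 i]
      ring
  have h0 : (PowerSeries.mk (shiftedSum κ m) : ℝ⟦X⟧) = 1 := by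
    ext n
    rcases n with _ | n
    · simp [shiftedSum_zero_right]
    · simp [shiftedSum_eq_zero hκ n m le_rfl, coeff_one]
  have h := key m
  rw [h0, sub_self, mul_zero, add_zero] at h
  rw [← h]
  ring

/-- Each difference of powers is divisible by `X * (f - g)`, hence so is `f - g` itself. As `1 - X *
e` has constant coefficient `1`, this forces `f - g = 0`. -/
lemma powerSeries_unique {R : Type*} [CommRing R] [IsDomain R] (c : ℕ → R) (s : Finset ℕ)
    {f g : R⟦X⟧} (hf : f = 1 + ∑ n ∈ s, C (c n) * (X * f) ^ n)
    (hg : g = 1 + ∑ n ∈ s, C (c n) * (X * g) ^ n) : f = g := by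
  have h1 : ∀ n ∈ s, X * (f - g) ∣ C (c n) * (X * f) ^ n - C (c n) * (X * g) ^ n := by
    intro n hn
    rw [← mul_sub, mul_sub X]
    exact (sub_dvd_pow_sub_pow _ _ _).mul_left _
  have h2 : X * (f - g) ∣ f - g := by
    nth_rewrite 2 [hf]
    nth_rewrite 2 [hg]
    rw [add_sub_add_left_eq_sub, ← sum_sub_distrib]
    exact dvd_sum h1
  obtain ⟨e, he⟩ := h2
  have h3 : (f - g) * (1 - X * e) = 0 := by
    linear_combination he
  rcases mul_eq_zero.1 h3 with h | h
  · exact sub_eq_zero.1 h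
  · have := congrArg (constantCoeff (R := R)) h
    simp at this

/-! ### Evaluation of complex power series -/

/-- `f` converges absolutely at `z`, with sum `a`. -/
def HasEval (z : ℂ) (f : ℂ⟦X⟧) (a : ℂ) : Prop :=
  (Summable fun n => ‖coeff n f * z ^ n‖) ∧ HasSum (fun n => coeff n f * z ^ n) a

namespace HasEval

variable {z : ℂ} {f g : ℂ⟦X⟧} {a b : ℂ}

lemma add (hf : HasEval z f a) (hg : HasEval z g b) : HasEval z (f + g) (a + b) := by
  constructor
  · refine Summable.of_nonneg_of_le (fun _ => norm_nonneg _) (fun n => ?_) (hf.1.add hg.1)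
    rw [map_add, add_mul]
    exact norm_add_le _ _
  · simpa [add_mul] using hf.2.add hg.2

lemma mul (hf : HasEval z f a) (hg : HasEval z g b) : HasEval z (f * g) (a * b) := by
  have hterm : ∀ n, coeff n (f * g) * z ^ n =
      ∑ kl ∈ antidiagonal n, (coeff kl.1 f * z ^ kl.1) * (coeff kl.2 g * z ^ kl.2) := by
    intro n
    rw [coeff_mul, sum_mul]
    refine sum_congr rfl fun kl hkl => ?_
    rw [← mem_antidiagonal.1 hkl, pow_add]
    ring
  have hs := summable_norm_sum_mul_antidiagonal_of_summable_norm hf.1 hg.1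
  have ht := tsum_mul_tsum_eq_tsum_sum_antidiagonal_of_summable_norm hf.1 hg.1
  rw [hf.2.tsum_eq, hg.2.tsum_eq] at ht
  simp only [← hterm] at hs ht
  exact ⟨hs, ht ▸ hs.of_norm.hasSum⟩

lemma const (z c : ℂ) : HasEval z (C c) c := by
  have h : ∀ n, n ≠ 0 → coeff n (C c) * z ^ n = 0 := fun n hn => by
    rw [coeff_C, if_neg hn, zero_mul]
  constructor
  · exact summable_of_ne_finset_zero (s := {0}) fun n hn => by
      rw [h n (by simpa using hn), norm_zero]
  · simpa using hasSum_single (f := fun n => coeff n (C c) * z ^ n) 0 h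

lemma one (z : ℂ) : HasEval z 1 1 := by simpa using const z 1

lemma X (z : ℂ) : HasEval z X z := by
  have h : ∀ n, n ≠ 1 → coeff n (PowerSeries.X : ℂ⟦X⟧) * z ^ n = 0 := fun n hn => by
    rw [coeff_X, if_neg hn, zero_mul]
  constructor
  · exact summable_of_ne_finset_zero (s := {1}) fun n hn => by
      rw [h n (by simpa using hn), norm_zero]
  · simpa using hasSum_single (f := fun n => coeff n (PowerSeries.X : ℂ⟦X⟧) * z ^ n) 1 h

lemma pow (hf : HasEval z f a) (n : ℕ) : HasEval z (f ^ n) (a ^ n) := by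
  induction n with
  | zero => simpa using one z
  | succ n ih => simpa [pow_succ] using ih.mul hf

lemma sum {ι : Type*} (s : Finset ι) {f : ι → ℂ⟦X⟧} {a : ι → ℂ}
    (h : ∀ i ∈ s, HasEval z (f i) (a i)) : HasEval z (∑ i ∈ s, f i) (∑ i ∈ s, a i) := by
  classical
  induction s using Finset.induction_on with
  | empty => simpa using const z 0
  | insert i s his ih =>
    rw [sum_insert his, sum_insert his]
    exact (h i (mem_insert_self _ _)).add (ih fun j hj => h j (mem_insert_of_mem hj))

lemma neg (hf : HasEval z f a) : HasEval z (-f) (-a) := by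
  simpa using (const z (-1)).mul hf

end HasEval

-- The identity theorem. Zeros that accumulate at `0` suffice, which matters because the functional
-- equation will be known only on a half-plane.
open Filter Topology in
lemma powerSeries_eq_zero {f : ℂ⟦X⟧} {F : ℂ → ℂ} (hF : ∀ᶠ z in 𝓝 0, HasEval z f (F z))
    (h0 : ∃ᶠ z in 𝓝[≠] 0, F z = 0) : f = 0 := by
  set p : FormalMultilinearSeries ℂ ℂ ℂ :=
    FormalMultilinearSeries.ofScalars ℂ (fun n => coeff n f) with hp
  have hpc : ∀ n, p.coeff n = coeff n f := fun n => by
    simp [hp, FormalMultilinearSeries.coeff_ofScalars]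
  have hser : HasFPowerSeriesAt F p 0 := by
    rw [hasFPowerSeriesAt_iff]
    filter_upwards [hF] with z hz
    simpa [hpc, mul_comm] using hz.2
  have hev := hser.analyticAt.frequently_zero_iff_eventually_zero.1 h0
  have hp0 : p = 0 := by
    have h1 : HasFPowerSeriesAt (0 : ℂ → ℂ) p 0 := hser.congr hev
    exact h1.eq_zero
  ext n
  rw [← hpc, hp0]
  simp [FormalMultilinearSeries.coeff]

end FreeProb

/-! ### The map z + φ(z) and the component Ω -/

namespace FreeProb

open Filter Topology Set
open scoped ComplexConjugate

/-- The function `z + φ(z)`. -/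
noncomputable def kmap (κ : ℕ → ℝ) (m : ℕ) (z : ℂ) : ℂ := z + phi κ m z

variable {κ : ℕ → ℝ} {m : ℕ}

lemma phi_conj (κ : ℕ → ℝ) (m : ℕ) (z : ℂ) : phi κ m (conj z) = conj (phi κ m z) := by
  simp [phi, map_sum, map_div₀]

lemma kmap_conj (κ : ℕ → ℝ) (m : ℕ) (z : ℂ) : kmap κ m (conj z) = conj (kmap κ m z) := by
  simp [kmap, phi_conj]

lemma kmap_im_eq_zero (κ : ℕ → ℝ) (m : ℕ) {z : ℂ} (hz : z.im = 0) : (kmap κ m z).im = 0 := by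
  rw [← Complex.conj_eq_iff_im, ← kmap_conj, Complex.conj_eq_iff_im.2 hz]

lemma differentiableAt_phi (κ : ℕ → ℝ) (m : ℕ) {z : ℂ} (hz : z ≠ 0) :
    DifferentiableAt ℂ (phi κ m) z := by
  unfold phi
  refine DifferentiableAt.fun_sum fun n _ => ?_
  exact (differentiableAt_const _).div (differentiableAt_id.pow _) (pow_ne_zero _ hz)

lemma differentiableAt_kmap (κ : ℕ → ℝ) (m : ℕ) {z : ℂ} (hz : z ≠ 0) :
    DifferentiableAt ℂ (kmap κ m) z :=
  differentiableAt_id.add (differentiableAt_phi κ m hz)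

lemma continuousAt_kmap (κ : ℕ → ℝ) (m : ℕ) {z : ℂ} (hz : z ≠ 0) :
    ContinuousAt (kmap κ m) z := (differentiableAt_kmap κ m hz).continuousAt

lemma analyticAt_kmap (κ : ℕ → ℝ) (m : ℕ) {z : ℂ} (hz : z ≠ 0) :
    AnalyticAt ℂ (kmap κ m) z := by
  have h : DifferentiableOn ℂ (kmap κ m) {0}ᶜ := fun w hw =>
    (differentiableAt_kmap κ m hw).differentiableWithinAt
  exact h.analyticAt (isOpen_compl_singleton.mem_nhds hz)

lemma exists_norm_phi_le (κ : ℕ → ℝ) (m : ℕ) {δ : ℝ} (hδ : 0 < δ) :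
    ∃ C : ℝ, 0 < C ∧ ∀ z : ℂ, δ ≤ ‖z‖ → ‖phi κ m z‖ ≤ C := by
  refine ⟨∑ n ∈ Finset.Icc 1 m, |κ n| / δ ^ (n - 1) + 1, ?_, fun z hz => ?_⟩
  · have : 0 ≤ ∑ n ∈ Finset.Icc 1 m, |κ n| / δ ^ (n - 1) :=
      Finset.sum_nonneg fun n _ => by positivity
    linarith
  · refine (norm_sum_le _ _).trans ((Finset.sum_le_sum fun n _ => ?_).trans
      (le_add_of_nonneg_right zero_le_one))
    rw [norm_div, norm_pow, Complex.norm_real, Real.norm_eq_abs]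
    gcongr

lemma norm_pow_sub_pow_le_mul {u v : ℂ} (hu : ‖u‖ ≤ 1) (hv : ‖v‖ ≤ 1) (k : ℕ) :
    ‖u ^ k - v ^ k‖ ≤ k * ‖u - v‖ := by
  induction k with
  | zero => simp
  | succ k ih =>
    have h : u ^ (k + 1) - v ^ (k + 1) = u ^ k * (u - v) + (u ^ k - v ^ k) * v := by ring
    rw [h]
    refine (norm_add_le _ _).trans ?_
    rw [norm_mul, norm_mul, norm_pow]
    have h1 : ‖u‖ ^ k ≤ 1 := pow_le_one₀ (norm_nonneg _) hu
    have h2 := mul_le_mul_of_nonneg_right h1 (norm_nonneg (u - v))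
    have h3 := mul_le_mul ih hv (norm_nonneg _) (by positivity)
    push_cast
    linarith

/-- In the variable `1/z`, `φ` is a polynomial and thus Lipschitz on the closed unit disc. -/
lemma exists_norm_phi_sub_le (κ : ℕ → ℝ) (m : ℕ) :
    ∃ L : ℝ, 0 < L ∧ ∀ z w : ℂ, 1 ≤ ‖z‖ → 1 ≤ ‖w‖ →
      ‖phi κ m z - phi κ m w‖ ≤ L * ‖z - w‖ / (‖z‖ * ‖w‖) := by
  refine ⟨∑ n ∈ Finset.Icc 1 m, |κ n| * (n - 1 : ℕ) + 1, ?_, fun z w hz hw => ?_⟩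
  · have : 0 ≤ ∑ n ∈ Finset.Icc 1 m, |κ n| * ((n - 1 : ℕ) : ℝ) :=
      Finset.sum_nonneg fun n _ => by positivity
    linarith
  · have hz0 : z ≠ 0 := norm_pos_iff.1 (by linarith)
    have hw0 : w ≠ 0 := norm_pos_iff.1 (by linarith)
    have hinv : ‖z⁻¹ - w⁻¹‖ = ‖z - w‖ / (‖z‖ * ‖w‖) := by
      rw [inv_sub_inv hz0 hw0, norm_div, norm_mul, norm_sub_rev]
    rw [mul_div_assoc, ← hinv, phi, phi, ← Finset.sum_sub_distrib, add_mul, Finset.sum_mul]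
    refine (norm_sum_le _ _).trans ((Finset.sum_le_sum fun n _ => ?_).trans
      (le_add_of_nonneg_right (by positivity)))
    have h : (κ n : ℂ) / z ^ (n - 1) - κ n / w ^ (n - 1) =
        κ n * (z⁻¹ ^ (n - 1) - w⁻¹ ^ (n - 1)) := by
      rw [inv_pow, inv_pow, div_eq_mul_inv, div_eq_mul_inv]
      ring
    rw [h, norm_mul, Complex.norm_real, Real.norm_eq_abs, mul_assoc]
    refine mul_le_mul_of_nonneg_left (norm_pow_sub_pow_le_mul ?_ ?_ _) (abs_nonneg _)
    · rw [norm_inv]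
      exact inv_le_one_of_one_le₀ hz
    · rw [norm_inv]
      exact inv_le_one_of_one_le₀ hw

/-- Near infinity `φ` is a contraction. -/
lemma exists_phi_contraction (κ : ℕ → ℝ) (m : ℕ) :
    ∃ R : ℝ, 1 ≤ R ∧ ∀ z w : ℂ, R ≤ ‖z‖ → R ≤ ‖w‖ →
      ‖phi κ m z - phi κ m w‖ ≤ 1 / 2 * ‖z - w‖ := by
  obtain ⟨L, hL, h⟩ := exists_norm_phi_sub_le κ m
  refine ⟨2 * L + 1, by linarith, fun z w hz hw => ?_⟩
  refine (h z w (by linarith) (by linarith)).trans ?_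
  have h1 : 2 * L ≤ ‖z‖ * ‖w‖ := by nlinarith
  rw [div_le_iff₀ (by nlinarith)]
  nlinarith [norm_nonneg (z - w)]

/-- `|Im φ(z)| ≤ Im z / 2` for large `z`. -/
lemma abs_im_phi_le {R : ℝ} (hR : ∀ z w : ℂ, R ≤ ‖z‖ → R ≤ ‖w‖ →
      ‖phi κ m z - phi κ m w‖ ≤ 1 / 2 * ‖z - w‖) {z : ℂ} (hz : R ≤ ‖z‖) :
    |(phi κ m z).im| ≤ 1 / 2 * |z.im| := by
  -- Since `φ` has real coefficients, comparing `z` with its conjugate bounds `2 Im φ(z)` by half of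
  -- `2 Im z`.
  have h := hR z (conj z) hz (by simpa using hz)
  rw [phi_conj, Complex.sub_conj, Complex.sub_conj] at h
  simp only [norm_mul, Complex.norm_real, Complex.norm_I, mul_one, Real.norm_eq_abs,
    abs_two] at h
  linarith

lemma ne_zero_of_im_pos {z : ℂ} (hz : 0 < z.im) : z ≠ 0 := by
  rintro rfl
  simp at hz

lemma isOpen_region (κ : ℕ → ℝ) (m : ℕ) : IsOpen (region κ m) := by
  rw [isOpen_iff_mem_nhds]
  intro z hz
  have h1 : ∀ᶠ w in 𝓝 z, 0 < w.im :=
    Complex.continuous_im.continuousAt.eventually (lt_mem_nhds hz.1)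
  have h2 : ∀ᶠ w in 𝓝 z, 0 < (kmap κ m w).im :=
    (Complex.continuous_im.continuousAt.comp
      (continuousAt_kmap κ m (ne_zero_of_im_pos hz.1))).eventually (lt_mem_nhds hz.2)
  filter_upwards [h1, h2] with w hw1 hw2 using ⟨hw1, hw2⟩

lemma mem_region_of_large {R : ℝ} (hR : ∀ z w : ℂ, R ≤ ‖z‖ → R ≤ ‖w‖ →
      ‖phi κ m z - phi κ m w‖ ≤ 1 / 2 * ‖z - w‖) {z : ℂ} (hz : R ≤ ‖z‖) (him : 0 < z.im) :
    z ∈ region κ m := by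
  refine ⟨him, ?_⟩
  have h := abs_im_phi_le hR hz
  rw [abs_of_pos him] at h
  have := neg_abs_le (phi κ m z).im
  rw [Complex.add_im]
  linarith

/-- The set is the image under `exp` of a convex half-strip. -/
lemma isPreconnected_upper_exterior {R : ℝ} (hR : 0 < R) :
    IsPreconnected {z : ℂ | 0 < z.im ∧ R < ‖z‖} := by
  have h : {z : ℂ | 0 < z.im ∧ R < ‖z‖} =
      Complex.exp '' (Ioi (Real.log R) ×ℂ Ioo 0 Real.pi) := by
    ext z
    simp only [mem_ofPred_eq, mem_image, Complex.mem_reProdIm, mem_Ioi, mem_Ioo]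
    constructor
    · rintro ⟨h1, h2⟩
      refine ⟨Complex.log z, ⟨?_, ?_, ?_⟩, Complex.exp_log (ne_zero_of_im_pos h1)⟩
      · rw [Complex.log_re]
        exact Real.log_lt_log hR h2
      · rw [Complex.log_im]
        refine lt_of_le_of_ne (Complex.arg_nonneg_iff.2 h1.le) fun h => ?_
        exact h1.ne' (Complex.arg_eq_zero_iff.1 h.symm).2
      · rw [Complex.log_im]
        refine lt_of_le_of_ne (Complex.arg_le_pi z) fun h => ?_
        exact h1.ne' (Complex.arg_eq_pi_iff.1 h).2
    · rintro ⟨w, ⟨h1, h2, h3⟩, rfl⟩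
      rw [Complex.exp_im, Complex.norm_exp]
      exact ⟨mul_pos (Real.exp_pos _) (Real.sin_pos_of_pos_of_lt_pi h2 h3),
        (Real.log_lt_iff_lt_exp hR).1 h1⟩
  rw [h]
  refine IsPreconnected.image ?_ _ Complex.continuous_exp.continuousOn
  exact (((convex_Ioi (Real.log R)).linear_preimage Complex.reLm).inter
    ((convex_Ioo 0 Real.pi).linear_preimage Complex.imLm)).isPreconnected

/-- `Omega` is one of the connected components of `region`. -/
lemma exists_Omega_eq (κ : ℕ → ℝ) (m : ℕ) : ∃ (R : ℝ) (p : ℂ), 1 ≤ R ∧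
    (∀ z w : ℂ, R ≤ ‖z‖ → R ≤ ‖w‖ → ‖phi κ m z - phi κ m w‖ ≤ 1 / 2 * ‖z - w‖) ∧
    p ∈ region κ m ∧ Omega κ m = connectedComponentIn (region κ m) p ∧
    {z : ℂ | 0 < z.im ∧ R < ‖z‖} ⊆ Omega κ m := by
  obtain ⟨R, hR1, hR⟩ := exists_phi_contraction κ m
  set U := {z : ℂ | 0 < z.im ∧ R < ‖z‖} with hU
  have hUreg : U ⊆ region κ m := fun z hz => mem_region_of_large hR hz.2.le hz.1
  have hUconn : IsPreconnected U := isPreconnected_upper_exterior (by linarith)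
  have hlarge : ∀ S : ℝ, ∃ q ∈ U, S < ‖q‖ := by
    intro S
    have hpos : 0 < max R S + 1 := by linarith [le_max_left R S]
    refine ⟨((max R S + 1 : ℝ) : ℂ) * Complex.I, ⟨?_, ?_⟩, ?_⟩
    · simpa using hpos
    · simp only [norm_mul, Complex.norm_I, mul_one, Complex.norm_real, Real.norm_eq_abs,
        abs_of_pos hpos]
      linarith [le_max_left R S]
    · simp only [norm_mul, Complex.norm_I, mul_one, Complex.norm_real, Real.norm_eq_abs,
        abs_of_pos hpos]
      linarith [le_max_right R S]
  obtain ⟨p, hpU, -⟩ := hlarge 0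
  have hUc : U ⊆ connectedComponentIn (region κ m) p :=
    hUconn.subset_connectedComponentIn hpU hUreg
  have hΩ : Omega κ m = connectedComponentIn (region κ m) p := by
    ext z
    constructor
    · rintro ⟨hz, S, hS⟩
      obtain ⟨q, hqU, hq⟩ := hlarge S
      have h1 := connectedComponentIn_eq (hS q hqU.1 hq)
      have h2 := connectedComponentIn_eq (hUc hqU)
      rw [h2, ← h1]
      exact mem_connectedComponentIn hz
    · intro hz
      refine ⟨connectedComponentIn_subset _ _ hz, R, fun w hw1 hw2 => ?_⟩
      rw [← connectedComponentIn_eq hz]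
      exact hUc ⟨hw1, hw2⟩
  exact ⟨R, p, hR1, hR, hUreg hpU, hΩ, hΩ ▸ hUc⟩

lemma Omega_nonempty (κ : ℕ → ℝ) (m : ℕ) : (Omega κ m).Nonempty := by
  obtain ⟨R, p, -, -, hp, hΩ, -⟩ := exists_Omega_eq κ m
  exact ⟨p, hΩ ▸ mem_connectedComponentIn hp⟩

lemma isOpen_Omega (κ : ℕ → ℝ) (m : ℕ) : IsOpen (Omega κ m) := by
  obtain ⟨R, p, -, -, hp, hΩ, -⟩ := exists_Omega_eq κ m
  exact hΩ ▸ (isOpen_region κ m).connectedComponentIn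

lemma isPreconnected_Omega (κ : ℕ → ℝ) (m : ℕ) : IsPreconnected (Omega κ m) := by
  obtain ⟨R, p, -, -, hp, hΩ, -⟩ := exists_Omega_eq κ m
  exact hΩ ▸ isPreconnected_connectedComponentIn

/-- A preconnected subset of `region` that meets `Omega` is contained in `Omega`. -/
lemma subset_Omega_of_isPreconnected {S : Set ℂ} (hS : IsPreconnected S)
    (hreg : S ⊆ region κ m) (hne : (S ∩ Omega κ m).Nonempty) : S ⊆ Omega κ m := by
  obtain ⟨R, p, -, -, hp, hΩ, -⟩ := exists_Omega_eq κ m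
  obtain ⟨q, hqS, hq⟩ := hne
  rw [hΩ] at hq ⊢
  rw [connectedComponentIn_eq hq]
  exact hS.subset_connectedComponentIn hqS hreg

/-- Components of an open set are open, so the component of `z` meets `Omega` and coincides with it.
-/
lemma mem_Omega_of_mem_closure {z : ℂ} (hz : z ∈ closure (Omega κ m)) (hreg : z ∈ region κ m) :
    z ∈ Omega κ m := by
  have hopen := (isOpen_region κ m).connectedComponentIn (x := z)
  have hself : z ∈ connectedComponentIn (region κ m) z := mem_connectedComponentIn hreg
  have hne := mem_closure_iff.1 hz _ hopen hself
  exact subset_Omega_of_isPreconnected isPreconnected_connectedComponentIn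
    (connectedComponentIn_subset _ _) hne hself

/-- A real point of large modulus lies in the frontier of `Omega`. -/
lemma mem_frontier_Omega_of_real {R : ℝ}
    (hU : {z : ℂ | 0 < z.im ∧ R < ‖z‖} ⊆ Omega κ m) {z : ℂ} (hz : z.im = 0) (hzR : R < ‖z‖) :
    z ∈ frontier (Omega κ m) := by
  rw [(isOpen_Omega κ m).frontier_eq]
  refine ⟨?_, fun h => h.1.1.ne' hz⟩
  have htend : Tendsto (fun ε : ℝ => z + ε * Complex.I) (𝓝[>] 0) (𝓝 z) := by
    have : Tendsto (fun ε : ℝ => z + ε * Complex.I) (𝓝 0) (𝓝 (z + (0 : ℝ) * Complex.I)) := by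
      refine Continuous.tendsto ?_ _
      fun_prop
    simp only [Complex.ofReal_zero, zero_mul, add_zero] at this
    exact this.mono_left nhdsWithin_le_nhds
  refine mem_closure_of_tendsto htend ?_
  have h2 : ∀ᶠ ε : ℝ in 𝓝[>] 0, R < ‖z + ε * Complex.I‖ := htend.norm.eventually (lt_mem_nhds hzR)
  filter_upwards [h2, self_mem_nhdsWithin] with ε h3 h4
  refine hU ⟨?_, h3⟩
  simpa [hz] using h4

/-- The leading behaviour of `z + φ(z)` at the pole `0`. -/
lemma exists_pole (hκ : ∀ n : ℕ, m + 1 ≤ n → κ n = 0) (hφ : ∃ n : ℕ, 2 ≤ n ∧ κ n ≠ 0) :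
    ∃ (k : ℕ) (c : ℝ) (q : Polynomial ℝ), 1 ≤ k ∧ c ≠ 0 ∧ q.eval 0 = 1 ∧
      ∀ z : ℂ, z ≠ 0 → kmap κ m z = c * Polynomial.aeval z q / z ^ k := by
  have hfin : {n : ℕ | κ n ≠ 0}.Finite := (finite_Iic m).subset fun n hn => by
    by_contra h
    exact hn (hκ n (by simpa using h))
  obtain ⟨n₀, hn₀, hn₀'⟩ := hφ
  have hne : (hfin.toFinset).Nonempty := ⟨n₀, by simpa using hn₀'⟩
  -- `N` is the largest index with `κ N ≠ 0`. Since `N ≥ 2`, `z + φ(z)` has a genuine pole at `0`,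
  -- of order `N - 1`.
  set N := hfin.toFinset.max' hne with hN
  have hN1 : κ N ≠ 0 := by simpa using Finset.max'_mem _ hne
  have hN2 : ∀ n, κ n ≠ 0 → n ≤ N := fun n hn => Finset.le_max' _ _ (by simpa using hn)
  have hN3 : 2 ≤ N := hn₀.trans (hN2 _ hn₀')
  have hN4 : N ≤ m := by
    by_contra h
    exact hN1 (hκ N (by omega))
  refine ⟨N - 1, κ N, Polynomial.C (κ N)⁻¹ * (Polynomial.X ^ N +
    ∑ n ∈ Finset.Icc 1 N, Polynomial.C (κ n) * Polynomial.X ^ (N - n)), by omega, hN1, ?_, ?_⟩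
  · rw [Polynomial.eval_mul, Polynomial.eval_add, Polynomial.eval_finsetSum,
      Finset.sum_eq_single_of_mem N (by simp; omega)]
    · simp [hN1, show N ≠ 0 by omega]
    · intro n hn hnN
      rw [Finset.mem_Icc] at hn
      simp [show N - n ≠ 0 by omega]
  · intro z hz
    have hphi : phi κ m z = ∑ n ∈ Finset.Icc 1 N, (κ n : ℂ) / z ^ (n - 1) := by
      rw [phi]
      symm
      refine Finset.sum_subset (Finset.Icc_subset_Icc le_rfl hN4) fun n hn hn' => ?_
      have : κ n = 0 := by
        by_contra h
        have := hN2 n h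
        simp only [Finset.mem_Icc] at hn hn'
        omega
      simp [this]
    have hNC : (κ N : ℂ) ≠ 0 := by exact_mod_cast hN1
    rw [kmap, hphi, eq_div_iff (pow_ne_zero _ hz), add_mul, Finset.sum_mul]
    simp only [map_mul, map_add, map_sum, map_pow, Polynomial.aeval_X, Polynomial.aeval_C,
      Complex.coe_algebraMap, Complex.ofReal_inv]
    rw [mul_inv_cancel_left₀ hNC]
    congr 1
    · rw [← pow_succ']
      congr 1
      omega
    · refine Finset.sum_congr rfl fun n hn => ?_
      rw [Finset.mem_Icc] at hn
      rw [div_mul_eq_mul_div, div_eq_iff (pow_ne_zero _ hz), mul_assoc, ← pow_add]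
      congr 2
      omega

lemma tendsto_norm_kmap_zero (hκ : ∀ n : ℕ, m + 1 ≤ n → κ n = 0)
    (hφ : ∃ n : ℕ, 2 ≤ n ∧ κ n ≠ 0) :
    Tendsto (fun z => ‖kmap κ m z‖) (𝓝[≠] 0) atTop := by
  obtain ⟨k, c, q, hk, hc, hq, hK⟩ := exists_pole hκ hφ
  have h1 : Tendsto (fun z : ℂ => ‖(c : ℂ) * Polynomial.aeval z q‖) (𝓝[≠] 0) (𝓝 |c|) := by
    have hcont : Continuous fun z : ℂ => ‖(c : ℂ) * Polynomial.aeval z q‖ := by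
      have := Polynomial.continuous_aeval (A := ℂ) q
      fun_prop
    have h := (hcont.tendsto 0).mono_left (nhdsWithin_le_nhds (s := {0}ᶜ))
    have h0 : Polynomial.aeval (0 : ℂ) q = 1 := by
      have := Polynomial.aeval_algebraMap_apply ℂ (0 : ℝ) q
      simpa [hq] using this
    simpa [h0] using h
  have h2 : Tendsto (fun z : ℂ => ‖z ^ k‖⁻¹) (𝓝[≠] 0) atTop := by
    refine Tendsto.inv_tendsto_nhdsGT_zero ?_
    rw [tendsto_nhdsWithin_iff]
    constructor
    · have : Continuous fun z : ℂ => ‖z ^ k‖ := by fun_prop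
      have h := (this.tendsto 0).mono_left (nhdsWithin_le_nhds (s := {0}ᶜ))
      simpa [show k ≠ 0 by omega] using h
    · filter_upwards [self_mem_nhdsWithin] with z hz
      exact norm_pos_iff.2 (pow_ne_zero _ hz)
  have h3 := h1.pos_mul_atTop (abs_pos.2 hc) h2
  refine h3.congr' ?_
  filter_upwards [self_mem_nhdsWithin] with z hz
  rw [hK z hz, norm_div, div_eq_mul_inv]

end FreeProb

/-! ### Cauchy transforms and free cumulants -/

namespace FreeProb

open Filter Topology Set

/-- The Cauchy transform of a measure on the line. -/
noncomputable def cauchyTransform (μ : Measure ℝ) (w : ℂ) : ℂ := ∫ x : ℝ, (w - x)⁻¹ ∂μ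

lemma sub_ofReal_ne_zero {w : ℂ} (hw : w.im ≠ 0) (x : ℝ) : w - x ≠ 0 := by
  intro h
  apply hw
  have := congrArg Complex.im h
  simpa using this

lemma norm_inv_sub_ofReal_le {w : ℂ} (hw : w.im ≠ 0) (x : ℝ) : ‖(w - x)⁻¹‖ ≤ |w.im|⁻¹ := by
  rw [norm_inv]
  have h := Complex.abs_im_le_norm (w - x)
  simp only [Complex.sub_im, Complex.ofReal_im, sub_zero] at h
  exact inv_anti₀ (abs_pos.2 hw) h

lemma continuous_inv_sub_ofReal {w : ℂ} (hw : w.im ≠ 0) :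
    Continuous fun x : ℝ => (w - x)⁻¹ :=
  (by fun_prop : Continuous fun x : ℝ => w - x).inv₀ (sub_ofReal_ne_zero hw)

lemma integrable_inv_sub_ofReal (μ : Measure ℝ) [IsFiniteMeasure μ] {w : ℂ} (hw : w.im ≠ 0) :
    Integrable (fun x : ℝ => (w - x)⁻¹) μ :=
  Integrable.of_bound (continuous_inv_sub_ofReal hw).aestronglyMeasurable |w.im|⁻¹
    (Eventually.of_forall (norm_inv_sub_ofReal_le hw))

lemma differentiableAt_cauchyTransform (μ : Measure ℝ) [IsFiniteMeasure μ] {w : ℂ}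
    (hw : w.im ≠ 0) : DifferentiableAt ℂ (cauchyTransform μ) w := by
  have h : cauchyTransform μ = fun w => -resolventTransform μ w := by
    ext w
    rw [cauchyTransform, resolventTransform_apply, ← integral_neg]
    congr 1
    ext x
    rw [resolvent, Ring.inverse_eq_inv', ← inv_neg, neg_sub]
    rfl
  rw [h]
  refine (hasDerivAt_resolventTransform w ?_).differentiableAt.neg
  rintro ⟨x, -, rfl⟩
  exact hw (Complex.ofReal_im x)

lemma inv_sub_ofReal_im (w : ℂ) (x : ℝ) : ((w - x)⁻¹).im = -(w.im / ‖w - x‖ ^ 2) := by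
  rw [Complex.inv_im, Complex.normSq_eq_norm_sq]
  simp [neg_div]

lemma cauchyTransform_im (μ : Measure ℝ) [IsFiniteMeasure μ] {w : ℂ} (hw : w.im ≠ 0) :
    (cauchyTransform μ w).im = -∫ x : ℝ, w.im / ‖w - x‖ ^ 2 ∂μ := by
  rw [cauchyTransform, ← integral_neg]
  have h := (integral_im (𝕜 := ℂ) (integrable_inv_sub_ofReal μ hw)).symm
  simp only [RCLike.im_to_complex, inv_sub_ofReal_im] at h
  exact h

lemma integrable_im_div_sq (μ : Measure ℝ) [IsFiniteMeasure μ] {w : ℂ} (hw : w.im ≠ 0) :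
    Integrable (fun x : ℝ => w.im / ‖w - x‖ ^ 2) μ := by
  have h := (integrable_inv_sub_ofReal μ hw).im.neg
  refine h.congr (Eventually.of_forall fun x => ?_)
  simp only [Pi.neg_apply, RCLike.im_to_complex, inv_sub_ofReal_im, neg_neg]

lemma cauchyTransform_im_neg (μ : Measure ℝ) [IsProbabilityMeasure μ] {w : ℂ} (hw : 0 < w.im) :
    (cauchyTransform μ w).im < 0 := by
  rw [cauchyTransform_im μ hw.ne', neg_lt_zero]
  have hpos : ∀ x : ℝ, 0 < w.im / ‖w - x‖ ^ 2 := fun x =>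
    div_pos hw (pow_pos (norm_pos_iff.2 (sub_ofReal_ne_zero hw.ne' x)) 2)
  rw [integral_pos_iff_support_of_nonneg (fun x => (hpos x).le) (integrable_im_div_sq μ hw.ne')]
  have : Function.support (fun x : ℝ => w.im / ‖w - x‖ ^ 2) = univ :=
    eq_univ_of_forall fun x => (hpos x).ne'
  rw [this, measure_univ]
  exact one_pos

lemma CompactlySupported.exists_bound {μ : Measure ℝ} (h : CompactlySupported μ) :
    ∃ A : ℝ, 0 < A ∧ ∀ᵐ x ∂μ, |x| ≤ A := by
  obtain ⟨K, hK, hμ⟩ := h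
  obtain ⟨A, hA, hKA⟩ := hK.isBounded.exists_pos_norm_le
  refine ⟨A, hA, ?_⟩
  filter_upwards [compl_mem_ae_iff.2 hμ] with x hx
  rw [compl_compl] at hx
  exact hKA x hx

lemma norm_cauchyTransform_le {μ : Measure ℝ} [IsProbabilityMeasure μ] {A : ℝ}
    (hA : ∀ᵐ x ∂μ, |x| ≤ A) {w : ℂ} (hw : A < ‖w‖) :
    ‖cauchyTransform μ w‖ ≤ (‖w‖ - A)⁻¹ := by
  have h := norm_integral_le_of_norm_le_const (μ := μ) (f := fun x : ℝ => (w - x)⁻¹)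
    (C := (‖w‖ - A)⁻¹) ?_
  · simpa [cauchyTransform] using h
  · filter_upwards [hA] with x hx
    rw [norm_inv]
    refine inv_anti₀ (by linarith) ?_
    have h1 := norm_sub_norm_le w x
    rw [Complex.norm_real, Real.norm_eq_abs] at h1
    linarith

/-- The moment generating function `∫ (1 - z x)⁻¹ dμ`. -/
noncomputable def momentFun (μ : Measure ℝ) (z : ℂ) : ℂ := ∫ x : ℝ, (1 - z * x)⁻¹ ∂μ

lemma cauchyTransform_eq_momentFun (μ : Measure ℝ) {w : ℂ} (hw : w ≠ 0) :
    cauchyTransform μ w = w⁻¹ * momentFun μ w⁻¹ := by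
  rw [cauchyTransform, momentFun, ← integral_const_mul]
  congr 1
  ext x
  rw [← mul_inv, mul_sub, mul_inv_cancel_left₀ hw, mul_one]

/-- The generating series of the moments, with complex coefficients. -/
noncomputable def momentSeries (μ : Measure ℝ) : PowerSeries ℂ :=
  PowerSeries.mk fun n => ((∫ x, x ^ n ∂μ : ℝ) : ℂ)

lemma hasEval_momentSeries {μ : Measure ℝ} [IsProbabilityMeasure μ] {A : ℝ} (hA0 : 0 < A)
    (hA : ∀ᵐ x ∂μ, |x| ≤ A) {z : ℂ} (hz : A * ‖z‖ < 1) :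
    HasEval z (momentSeries μ) (momentFun μ z) := by
  have hterm : ∀ n, PowerSeries.coeff n (momentSeries μ) * z ^ n =
      ∫ x : ℝ, ((z * x) ^ n : ℂ) ∂μ := by
    intro n
    rw [momentSeries, PowerSeries.coeff_mk, ← integral_complex_ofReal, ← integral_mul_const]
    congr 1
    ext x
    push_cast
    ring
  have hbound : ∀ n : ℕ, ∀ᵐ x : ℝ ∂μ, ‖((z * x) ^ n : ℂ)‖ ≤ (A * ‖z‖) ^ n := by
    intro n
    filter_upwards [hA] with x hx
    rw [norm_pow, norm_mul, Complex.norm_real, Real.norm_eq_abs, mul_comm]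
    gcongr
  have hgeo : Summable fun n : ℕ => (A * ‖z‖) ^ n :=
    summable_geometric_of_lt_one (by positivity) hz
  constructor
  · refine Summable.of_nonneg_of_le (fun _ => norm_nonneg _) (fun n => ?_) hgeo
    rw [hterm]
    simpa using norm_integral_le_of_norm_le_const (hbound n)
  · simp only [hterm]
    refine hasSum_integral_of_dominated_convergence (fun n _ => (A * ‖z‖) ^ n)
      (fun n => by fun_prop) hbound
      (Eventually.of_forall fun _ => hgeo) (integrable_const _) ?_
    filter_upwards [hA] with x hx
    refine hasSum_geometric_of_norm_lt_one (lt_of_le_of_lt ?_ hz)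
    rw [norm_mul, Complex.norm_real, Real.norm_eq_abs, mul_comm]
    gcongr

/-- The functional equation of the moment generating series, over `ℂ`. -/
lemma map_nonCrossingSum_eq {κ : ℕ → ℝ} {m : ℕ} (hκ : ∀ n, m + 1 ≤ n → κ n = 0) :
    (PowerSeries.mk fun n => ((nonCrossingSum κ n : ℝ) : ℂ)) =
      1 + ∑ s ∈ Finset.Icc 1 m, PowerSeries.C (κ s : ℂ) *
        (PowerSeries.X * PowerSeries.mk fun n => ((nonCrossingSum κ n : ℝ) : ℂ)) ^ s := by
  have h := congrArg (PowerSeries.map Complex.ofRealHom) (mk_nonCrossingSum_eq hκ)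
  have h1 : PowerSeries.map Complex.ofRealHom (PowerSeries.mk (nonCrossingSum κ)) =
      PowerSeries.mk fun n => ((nonCrossingSum κ n : ℝ) : ℂ) := by
    ext n
    simp
  rw [map_add, map_one, map_sum] at h
  simp only [map_mul, map_pow, PowerSeries.map_X, PowerSeries.map_C, h1] at h
  exact h

variable {κ : ℕ → ℝ} {m : ℕ}

/-- Multiplication by `g` turns the inverse-function relation into the equation of the moment
series, with `g` in the place of `X M`. -/
lemma kmap_inv_eq_iff {g w : ℂ} (hg : g ≠ 0) :
    kmap κ m g⁻¹ = w ↔ 1 + ∑ s ∈ Finset.Icc 1 m, (κ s : ℂ) * g ^ s = w * g := by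
  have h : kmap κ m g⁻¹ * g = 1 + ∑ s ∈ Finset.Icc 1 m, (κ s : ℂ) * g ^ s := by
    rw [kmap, phi, add_mul, inv_mul_cancel₀ hg, Finset.sum_mul]
    congr 1
    refine Finset.sum_congr rfl fun n hn => ?_
    rw [Finset.mem_Icc] at hn
    rw [inv_pow, div_inv_eq_mul, mul_assoc, ← pow_succ]
    congr 2
    omega
  rw [← h, mul_left_inj' hg]

/-- The moment series is evaluated at `z = 1/w`; for `w` in the upper half-plane these points fill
the lower one, which accumulates at `0`. -/
lemma frequently_im_neg : ∃ᶠ z : ℂ in 𝓝[≠] 0, z.im < 0 := by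
  have htend : Tendsto (fun t : ℝ => -(t : ℂ) * Complex.I) (𝓝[>] 0) (𝓝[≠] 0) := by
    rw [tendsto_nhdsWithin_iff]
    constructor
    · have : Continuous fun t : ℝ => -(t : ℂ) * Complex.I := by fun_prop
      simpa using (this.tendsto 0).mono_left (nhdsWithin_le_nhds (s := Ioi 0))
    · filter_upwards [self_mem_nhdsWithin] with t ht
      have ht' : t ≠ 0 := (mem_Ioi.1 ht).ne'
      simpa using ht'
  refine htend.frequently (Eventually.frequently ?_)
  filter_upwards [self_mem_nhdsWithin] with t ht
  simpa using ht

/-- A compactly supported probability measure has free cumulants `κ` if the reciprocal of its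
Cauchy transform is a right inverse of `z + φ(z)`. -/
lemma isFreeCumulantSeq_of_kmap {μ : Measure ℝ} [IsProbabilityMeasure μ]
    (hμ : CompactlySupported μ) (hκ : ∀ n, m + 1 ≤ n → κ n = 0)
    (h : ∀ w : ℂ, 0 < w.im → kmap κ m (cauchyTransform μ w)⁻¹ = w) :
    IsFreeCumulantSeq μ κ := by
  obtain ⟨A, hA0, hA⟩ := hμ.exists_bound
  set f := momentSeries μ with hf
  have hev : ∀ᶠ z : ℂ in 𝓝 0, HasEval z
      (f - (1 + ∑ s ∈ Finset.Icc 1 m, PowerSeries.C (κ s : ℂ) * (PowerSeries.X * f) ^ s))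
      (momentFun μ z - (1 + ∑ s ∈ Finset.Icc 1 m, (κ s : ℂ) * (z * momentFun μ z) ^ s)) := by
    have h1 : ∀ᶠ z : ℂ in 𝓝 0, A * ‖z‖ < 1 := by
      have : Continuous fun z : ℂ => A * ‖z‖ := by fun_prop
      exact (this.tendsto 0).eventually (gt_mem_nhds (by simp))
    filter_upwards [h1] with z hz
    have h2 := hasEval_momentSeries hA0 hA hz
    rw [sub_eq_add_neg, sub_eq_add_neg]
    refine h2.add (HasEval.neg ((HasEval.one z).add (HasEval.sum _ fun s _ => ?_)))
    exact (HasEval.const z _).mul (((HasEval.X z).mul h2).pow s)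
  have hzero := powerSeries_eq_zero hev (frequently_im_neg.mono fun z hz => by
    have hz0 : z ≠ 0 := by
      rintro rfl
      simp at hz
    have hw : 0 < (z⁻¹).im := by
      rw [Complex.inv_im]
      exact div_pos (by linarith) (Complex.normSq_pos.2 hz0)
    have h1 := h _ hw
    have hG : cauchyTransform μ z⁻¹ ≠ 0 := by
      intro h0
      have := cauchyTransform_im_neg μ hw
      simp [h0] at this
    rw [kmap_inv_eq_iff hG, cauchyTransform_eq_momentFun μ (inv_ne_zero hz0), inv_inv,
      inv_mul_cancel_left₀ hz0] at h1
    rw [h1, sub_self])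
  have heq := powerSeries_unique (fun n => (κ n : ℂ)) (Finset.Icc 1 m) (sub_eq_zero.1 hzero)
    (map_nonCrossingSum_eq hκ)
  intro n _
  have := congrArg (PowerSeries.coeff n) heq
  rw [hf, momentSeries, PowerSeries.coeff_mk, PowerSeries.coeff_mk] at this
  exact_mod_cast this

lemma isOpen_im_pos : IsOpen {z : ℂ | 0 < z.im} :=
  isOpen_lt continuous_const Complex.continuous_im

lemma isPreconnected_im_pos : IsPreconnected {z : ℂ | 0 < z.im} :=
  (convex_halfSpace_im_gt 0).isPreconnected

/-- If `μ` has free cumulants `κ`, then the reciprocal of its Cauchy transform is a right inverse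
of `z + φ(z)` on the upper half-plane. -/
lemma kmap_inv_cauchyTransform {μ : Measure ℝ} [IsProbabilityMeasure μ]
    (hμ : CompactlySupported μ) (hκ : ∀ n, m + 1 ≤ n → κ n = 0)
    (h : IsFreeCumulantSeq μ κ) {w : ℂ} (hw : 0 < w.im) :
    kmap κ m (cauchyTransform μ w)⁻¹ = w := by
  obtain ⟨A, hA0, hA⟩ := hμ.exists_bound
  have hser : momentSeries μ = PowerSeries.mk fun n => ((nonCrossingSum κ n : ℝ) : ℂ) := by
    ext n
    rw [momentSeries, PowerSeries.coeff_mk, PowerSeries.coeff_mk]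
    rcases Nat.eq_zero_or_pos n with rfl | hn
    · simp [nonCrossingSum_zero]
    · rw [h n hn]
  set P : ℂ → ℂ := fun w =>
    1 + ∑ s ∈ Finset.Icc 1 m, (κ s : ℂ) * cauchyTransform μ w ^ s with hP
  set Q : ℂ → ℂ := fun w => w * cauchyTransform μ w with hQ
  have hdiff : DifferentiableOn ℂ (cauchyTransform μ) {z | 0 < z.im} := fun z hz =>
    (differentiableAt_cauchyTransform μ (ne_of_gt hz)).differentiableWithinAt
  have hPan : AnalyticOnNhd ℂ P {z | 0 < z.im} := by
    refine DifferentiableOn.analyticOnNhd ?_ isOpen_im_pos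
    refine (differentiableOn_const _).add (DifferentiableOn.fun_sum fun s _ => ?_)
    exact (differentiableOn_const _).mul (hdiff.pow s)
  have hQan : AnalyticOnNhd ℂ Q {z | 0 < z.im} :=
    DifferentiableOn.analyticOnNhd (differentiableOn_id.mul hdiff) isOpen_im_pos
  have hlarge : ∀ w : ℂ, A < ‖w‖ → P w = Q w := by
    intro w hw
    have hw0 : w ≠ 0 := norm_pos_iff.1 (hA0.trans hw)
    have hz : A * ‖w⁻¹‖ < 1 := by
      rw [norm_inv, ← div_eq_mul_inv, div_lt_one (hA0.trans hw)]
      exact hw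
    have h1 := hasEval_momentSeries hA0 hA hz
    have h2 : HasEval w⁻¹ (momentSeries μ)
        (1 + ∑ s ∈ Finset.Icc 1 m, (κ s : ℂ) * (w⁻¹ * momentFun μ w⁻¹) ^ s) := by
      rw [hser] at h1 ⊢
      rw [map_nonCrossingSum_eq hκ]
      refine (HasEval.one _).add (HasEval.sum _ fun s _ => ?_)
      exact (HasEval.const _ _).mul (((HasEval.X _).mul h1).pow s)
    have h3 := h1.2.unique h2.2
    rw [← cauchyTransform_eq_momentFun μ hw0] at h3
    simp only [hP, hQ]
    rw [← h3, cauchyTransform_eq_momentFun μ hw0, mul_inv_cancel_left₀ hw0]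
  -- Convergence of the moment series gives `P = Q` only for `‖w‖ > A`; analytic continuation
  -- extends it to the whole half-plane.
  have hEq : EqOn P Q {z | 0 < z.im} := by
    refine hPan.eqOn_of_preconnected_of_eventuallyEq hQan isPreconnected_im_pos
      (z₀ := ((A + 1 : ℝ) : ℂ) * Complex.I) ?_ ?_
    · have : 0 < A + 1 := by linarith
      simpa using this
    · have hn : A < ‖((A + 1 : ℝ) : ℂ) * Complex.I‖ := by
        rw [norm_mul, Complex.norm_I, mul_one, Complex.norm_real, Real.norm_eq_abs,
          abs_of_pos (by linarith)]
        linarith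
      filter_upwards [continuous_norm.continuousAt.eventually (lt_mem_nhds hn)] with w hw
      exact hlarge w hw
  have hG : cauchyTransform μ w ≠ 0 := by
    intro h0
    have := cauchyTransform_im_neg μ hw
    simp [h0] at this
  exact (kmap_inv_eq_iff hG).2 (hEq hw)

/-- If `μ` has free cumulants `κ`, then the reciprocal of its Cauchy transform is a left inverse
of `z + φ(z)` on `Omega`. -/
lemma inv_cauchyTransform_kmap {μ : Measure ℝ} [IsProbabilityMeasure μ]
    (hμ : CompactlySupported μ) (hκ : ∀ n, m + 1 ≤ n → κ n = 0)
    (h : IsFreeCumulantSeq μ κ) {z : ℂ} (hz : z ∈ Omega κ m) :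
    (cauchyTransform μ (kmap κ m z))⁻¹ = z := by
  obtain ⟨A, hA0, hA⟩ := hμ.exists_bound
  obtain ⟨R, p, hR1, -, -, -, hU⟩ := exists_Omega_eq κ m
  set F : ℂ → ℂ := fun w => (cauchyTransform μ w)⁻¹ with hF
  have hKF : ∀ w : ℂ, 0 < w.im → kmap κ m (F w) = w := fun w hw =>
    kmap_inv_cauchyTransform hμ hκ h hw
  have hGne : ∀ w : ℂ, 0 < w.im → cauchyTransform μ w ≠ 0 := fun w hw h0 => by
    have := cauchyTransform_im_neg μ hw
    simp [h0] at this
  have hFim : ∀ w : ℂ, 0 < w.im → 0 < (F w).im := fun w hw => by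
    rw [hF, Complex.inv_im]
    exact div_pos (by linarith [cauchyTransform_im_neg μ hw]) (Complex.normSq_pos.2 (hGne w hw))
  have hFdiff : ∀ w : ℂ, 0 < w.im → DifferentiableAt ℂ F w := fun w hw =>
    (differentiableAt_cauchyTransform μ hw.ne').inv (hGne w hw)
  have hFlarge : ∀ w : ℂ, 0 < w.im → A + R < ‖w‖ → R < ‖F w‖ := fun w hw hwn => by
    have h1 := norm_cauchyTransform_le hA (w := w) (by linarith)
    rw [hF, norm_inv]
    rw [lt_inv_comm₀ (by linarith) (norm_pos_iff.2 (hGne w hw))]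
    refine h1.trans_lt ?_
    exact inv_strictAnti₀ (by linarith) (by linarith)
  set w₀ : ℂ := ((A + R + 1 : ℝ) : ℂ) * Complex.I with hw₀
  have hw₀im : 0 < w₀.im := by
    have : 0 < A + R + 1 := by linarith
    simpa [hw₀] using this
  have hw₀n : A + R < ‖w₀‖ := by
    rw [hw₀, norm_mul, Complex.norm_I, mul_one, Complex.norm_real, Real.norm_eq_abs,
      abs_of_pos (by linarith)]
    linarith
  -- The image is connected, lies in `region` because `K ∘ F = id`, and contains the large point `F
  -- w₀` of `Omega`.
  have hFΩ : F '' {w | 0 < w.im} ⊆ Omega κ m := by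
    refine subset_Omega_of_isPreconnected (isPreconnected_im_pos.image _ fun w hw =>
      (hFdiff w hw).continuousAt.continuousWithinAt) ?_ ?_
    · rintro _ ⟨w, hw, rfl⟩
      refine ⟨hFim w hw, ?_⟩
      change 0 < (kmap κ m (F w)).im
      rw [hKF w hw]
      exact hw
    · exact ⟨F w₀, ⟨w₀, hw₀im, rfl⟩, hU ⟨hFim w₀ hw₀im, hFlarge w₀ hw₀im hw₀n⟩⟩
  have hFan : AnalyticOnNhd ℂ F {w | 0 < w.im} :=
    DifferentiableOn.analyticOnNhd (fun w hw => (hFdiff w hw).differentiableWithinAt)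
      isOpen_im_pos
  have hFopen : IsOpen (F '' {w | 0 < w.im}) := by
    rcases hFan.is_constant_or_isOpen isPreconnected_im_pos with ⟨c, hc⟩ | hop
    · exfalso
      have h1 : kmap κ m c = w₀ := by rw [← hc w₀ hw₀im, hKF w₀ hw₀im]
      have h2im : 0 < (w₀ + w₀).im := by
        rw [Complex.add_im]
        linarith
      have h2 : kmap κ m c = w₀ + w₀ := by rw [← hc _ h2im, hKF _ h2im]
      rw [h1] at h2
      have : w₀ = 0 := by linear_combination -h2
      simp [this] at hw₀im
    · exact hop _ subset_rfl isOpen_im_pos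
  have hcomp : AnalyticOnNhd ℂ (fun z => F (kmap κ m z)) (Omega κ m) := by
    refine DifferentiableOn.analyticOnNhd (fun z hz => ?_) (isOpen_Omega κ m)
    have hz' : 0 < (kmap κ m z).im := hz.1.2
    exact ((hFdiff _ hz').comp z
      (differentiableAt_kmap κ m (ne_zero_of_im_pos hz.1.1))).differentiableWithinAt
  -- `F ∘ K` is the identity on the open image of `F`, hence on all of the connected set `Omega`.
  have heq := hcomp.eqOn_of_preconnected_of_eventuallyEq analyticOnNhd_id
    (isPreconnected_Omega κ m) (z₀ := F w₀) (hFΩ ⟨w₀, hw₀im, rfl⟩) (by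
      filter_upwards [hFopen.mem_nhds ⟨w₀, hw₀im, rfl⟩] with z hz
      obtain ⟨w, hw, rfl⟩ := hz
      simp only [hKF w hw])
  exact heq hz

/-! ### Curves from 0 to ∞ must meet the boundary -/

/-- A Jordan curve from `0` to `∞` that avoids the frontier of `Omega` runs inside `Omega`. -/
lemma IsJordanCurveZeroInfty.mem_Omega {γ : ℝ → ℂ} (hγ : IsJordanCurveZeroInfty γ)
    (h : ∀ t : ℝ, 0 < t → γ t ∉ frontier (Omega κ m)) {t : ℝ} (ht : 0 < t) :
    γ t ∈ Omega κ m := by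
  obtain ⟨R, p, hR1, -, -, -, hU⟩ := exists_Omega_eq κ m
  have hconn : IsPreconnected (γ '' Ioi 0) :=
    isPreconnected_Ioi.image _ (hγ.continuousOn.mono Ioi_subset_Ici_self)
  have hsub : γ '' Ioi 0 ⊆ Omega κ m := by
    refine hconn.subset_left_of_subset_union (isOpen_Omega κ m)
      (isClosed_closure (s := Omega κ m)).isOpen_compl ?_ ?_ ?_
    · exact disjoint_compl_right.mono_left subset_closure |>.mono_right le_rfl
    · rintro _ ⟨s, hs, rfl⟩
      by_contra hcon
      simp only [mem_union, mem_compl_iff, not_or, not_not] at hcon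
      refine h s hs ?_
      rw [(isOpen_Omega κ m).frontier_eq]
      exact ⟨hcon.2, hcon.1⟩
    -- Far out the curve cannot be on the real line, as large real points belong to the frontier; so
    -- it is in `Omega` there.
    · have h1 : ∀ᶠ t in atTop, R < ‖γ t‖ := by
        have := tendsto_norm_cocompact_atTop.comp hγ.tendsto
        exact this.eventually_gt_atTop R
      obtain ⟨s, hs1, hs2⟩ := (h1.and (eventually_gt_atTop 0)).exists
      refine ⟨γ s, ⟨s, hs2, rfl⟩, ?_⟩
      rcases (hγ.im_nonneg s hs2.le).eq_or_lt with h0 | h0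
      · exact absurd (mem_frontier_Omega_of_real hU h0.symm hs1) (h s hs2)
      · exact hU ⟨h0, hs1⟩
  exact hsub ⟨t, ht, rfl⟩

/-- Otherwise the curve stays in `Omega`, where `G(K(z)) = 1/z`. As `t → 0` the right side is
unbounded, while `K(γ t)` tends to `∞`, where `G` vanishes. -/
theorem exists_mem_frontier_Omega {μ : Measure ℝ} [IsProbabilityMeasure μ]
    (hμ : CompactlySupported μ) (hκ : ∀ n, m + 1 ≤ n → κ n = 0)
    (hφ : ∃ n : ℕ, 2 ≤ n ∧ κ n ≠ 0) (h : IsFreeCumulantSeq μ κ) {γ : ℝ → ℂ}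
    (hγ : IsJordanCurveZeroInfty γ) : ∃ t : ℝ, 0 < t ∧ γ t ∈ frontier (Omega κ m) := by
  by_contra! hcon
  have hΩ : ∀ t : ℝ, 0 < t → γ t ∈ Omega κ m := fun t ht => hγ.mem_Omega hcon ht
  obtain ⟨A, hA0, hA⟩ := hμ.exists_bound
  have htend : Tendsto γ (𝓝[>] 0) (𝓝[≠] 0) := by
    rw [tendsto_nhdsWithin_iff]
    constructor
    · have h1 := hγ.continuousOn 0 self_mem_Ici
      rw [ContinuousWithinAt, hγ.start] at h1
      exact h1.mono_left (nhdsWithin_mono _ Ioi_subset_Ici_self)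
    · filter_upwards [self_mem_nhdsWithin] with t ht
      exact ne_zero_of_im_pos (hΩ t ht).1.1
  have hK := (tendsto_norm_kmap_zero hκ hφ).comp htend
  have h0 : Tendsto (fun t => ‖γ t‖) (𝓝[>] 0) (𝓝 0) := by
    simpa using (htend.mono_right nhdsWithin_le_nhds).norm
  -- The bound `(‖w‖ - A)⁻¹` for `G` is at most `1` once `‖w‖ ≥ A + 1`, which contradicts `‖γ t‖ <
  -- 1`.
  have e1 := hK.eventually_ge_atTop (A + 1)
  have e2 := h0.eventually (gt_mem_nhds one_pos)
  obtain ⟨t, ⟨h1, h2⟩, h3⟩ := ((e1.and e2).and self_mem_nhdsWithin).exists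
  have h4 := inv_cauchyTransform_kmap hμ hκ h (hΩ t h3)
  have h5 := norm_cauchyTransform_le hA (w := kmap κ m (γ t)) (by
    simp only [Function.comp] at h1
    linarith)
  have h6 : (‖kmap κ m (γ t)‖ - A)⁻¹ ≤ 1 := inv_le_one_of_one_le₀ (by
    simp only [Function.comp] at h1
    linarith)
  have h7 : cauchyTransform μ (kmap κ m (γ t)) = (γ t)⁻¹ := by rw [← h4, inv_inv, h4]
  rw [h7, norm_inv] at h5
  have h8 : 0 < ‖γ t‖ := norm_pos_iff.2 (ne_zero_of_im_pos (hΩ t h3).1.1)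
  have h9 := one_lt_inv₀ h8 |>.2 h2
  linarith

end FreeProb

/-! ### Construction of simple arcs -/

namespace FreeProb

open Filter Topology Set

/-- `y` is the endpoint of a simple arc that starts at `0` and otherwise runs inside `U`. -/
def IsArcReachable (U : Set ℂ) (y : ℂ) : Prop :=
  ∃ T : ℝ, 0 < T ∧ ∃ α : ℝ → ℂ, ContinuousOn α (Icc 0 T) ∧ InjOn α (Icc 0 T) ∧ α 0 = 0 ∧
    α T = y ∧ ∀ t, 0 < t → t ≤ T → α t ∈ U

/-- Follow an arc until it first meets a piece of a straight line, and go on along the line. -/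
lemma exists_arc_concat_line {T : ℝ} (hT : 0 < T) {α : ℝ → ℂ} (hα : ContinuousOn α (Icc 0 T))
    (hinj : InjOn α (Icc 0 T)) {p d : ℂ} (hd : d ≠ 0) {I : Set ℝ}
    (hcl : IsClosed ((fun s : ℝ => p + s * d) '' I)) (hI0 : 0 ∈ I) (hend : α T = p)
    (hstart : α 0 ∉ (fun s : ℝ => p + s * d) '' I) :
    ∃ t₀ s₀ : ℝ, 0 < t₀ ∧ t₀ ≤ T ∧ s₀ ∈ I ∧ ∃ γ : ℝ → ℂ, ContinuousOn γ (Ici 0) ∧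
      (∀ t ≤ t₀, γ t = α t) ∧ (∀ t, t₀ ≤ t → γ t = p + (s₀ + (t - t₀) : ℝ) * d) ∧
      InjOn γ {t | 0 ≤ t ∧ (t ≤ t₀ ∨ s₀ + (t - t₀) ∈ I)} := by
  set S := (fun s : ℝ => p + s * d) '' I with hS
  -- Leaving the arc at its first meeting with the line piece, at time `inf H`, keeps the
  -- concatenation injective.
  set H := Icc 0 T ∩ α ⁻¹' S with hH
  have hHcl : IsClosed H := hα.preimage_isClosed_of_isClosed isClosed_Icc hcl
  have hHne : H.Nonempty := ⟨T, ⟨hT.le, le_rfl⟩, 0, hI0, by simp [hend]⟩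
  have hHb : BddBelow H := ⟨0, fun t ht => ht.1.1⟩
  set t₀ := sInf H with ht₀
  have hmem : t₀ ∈ H := hHcl.csInf_mem hHne hHb
  have hlt : ∀ t, 0 ≤ t → t < t₀ → α t ∉ S := fun t h0 ht hS' =>
    (csInf_le hHb ⟨⟨h0, ht.le.trans hmem.1.2⟩, hS'⟩).not_gt ht
  obtain ⟨⟨h0, h1⟩, s₀, hs₀, hαt₀⟩ := hmem
  simp only at hαt₀
  have hpos : 0 < t₀ := by
    rcases h0.eq_or_lt with h | h
    · exact absurd (h ▸ ⟨s₀, hs₀, hαt₀⟩) hstart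
    · exact h
  -- The line is followed for all later times, also beyond `I`, so that the same curve serves for
  -- segments and for rays; injectivity is claimed only while the parameter stays in `I`.
  set γ : ℝ → ℂ := fun t => if t ≤ t₀ then α t else p + (s₀ + (t - t₀) : ℝ) * d with hγ
  have e1 : ∀ t ≤ t₀, γ t = α t := fun t ht => if_pos ht
  have e2 : ∀ t, t₀ ≤ t → γ t = p + (s₀ + (t - t₀) : ℝ) * d := fun t ht => by
    rcases ht.eq_or_lt with h | h
    · rw [e1 t h.ge, ← h, ← hαt₀]
      simp
    · exact if_neg h.not_ge
  refine ⟨t₀, s₀, hpos, h1, hs₀, γ, ?_, e1, e2, ?_⟩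
  · have c1 : ContinuousOn γ (Icc 0 t₀) :=
      (hα.mono (Icc_subset_Icc_right h1)).congr fun t ht => e1 t ht.2
    have c2 : ContinuousOn γ (Ici t₀) := by
      refine ContinuousOn.congr (f := fun t => p + (s₀ + (t - t₀) : ℝ) * d) ?_ fun t ht => e2 t ht
      fun_prop
    have := c1.union_of_isClosed c2 isClosed_Icc isClosed_Ici
    rwa [Icc_union_Ici_eq_Ici h0] at this
  · have key : ∀ t u : ℝ, 0 ≤ t → t < u → (u ≤ t₀ ∨ s₀ + (u - t₀) ∈ I) → γ t ≠ γ u := by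
      intro t u ht htu hu heq
      rcases le_or_gt u t₀ with hut | hut
      · rw [e1 t (htu.le.trans hut), e1 u hut] at heq
        exact htu.ne (hinj ⟨ht, by linarith⟩ ⟨by linarith, by linarith⟩ heq)
      · have huI := hu.resolve_left hut.not_ge
        rw [e2 u hut.le] at heq
        rcases lt_or_ge t t₀ with htt | htt
        · rw [e1 t htt.le] at heq
          exact hlt t ht htt ⟨_, huI, heq.symm⟩
        · rw [e2 t htt] at heq
          have h3 := mul_right_cancel₀ hd (add_left_cancel heq)
          have h4 : s₀ + (t - t₀) = s₀ + (u - t₀) := by exact_mod_cast h3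
          linarith
    rintro t ⟨ht, ht'⟩ u ⟨hu, hu'⟩ heq
    rcases lt_trichotomy t u with h | h | h
    · exact absurd heq (key t u ht h hu')
    · exact h
    · exact absurd heq.symm (key u t hu h ht')

lemma IsArcReachable.of_segment {U : Set ℂ} (h0 : (0 : ℂ) ∉ U) {y y' : ℂ}
    (hy : IsArcReachable U y) (hseg : segment ℝ y y' ⊆ U) : IsArcReachable U y' := by
  rcases eq_or_ne y y' with rfl | hne
  · exact hy
  obtain ⟨T, hT, α, hα, hinj, hα0, hαT, hαU⟩ := hy
  have himg : (fun s : ℝ => y + s * (y' - y)) '' Icc 0 1 = segment ℝ y y' := by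
    rw [segment_eq_image']
    rfl
  have hcl : IsClosed ((fun s : ℝ => y + s * (y' - y)) '' Icc 0 1) :=
    (isCompact_Icc.image (by fun_prop)).isClosed
  obtain ⟨t₀, s₀, ht₀, ht₀T, hs₀, γ, hγ, e1, e2, hγinj⟩ :=
    exists_arc_concat_line hT hα hinj (sub_ne_zero.2 hne.symm) hcl ⟨le_rfl, zero_le_one⟩ hαT
      (by
        rw [himg, hα0]
        exact fun h => h0 (hseg h))
  -- The line is entered at parameter `s₀` and run with unit speed, so the endpoint `y'` is reached
  -- after the further time `1 - s₀`.
  have hT' : t₀ ≤ t₀ + (1 - s₀) := by linarith [hs₀.2]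
  refine ⟨t₀ + (1 - s₀), by linarith, γ, hγ.mono Icc_subset_Ici_self, hγinj.mono ?_, ?_, ?_, ?_⟩
  · rintro t ⟨h1, h2⟩
    refine ⟨h1, ?_⟩
    rcases le_or_gt t t₀ with h | h
    · exact Or.inl h
    · exact Or.inr ⟨by linarith [hs₀.1], by linarith⟩
  · rw [e1 0 ht₀.le, hα0]
  · rw [e2 _ hT']
    have : s₀ + (t₀ + (1 - s₀) - t₀) = 1 := by ring
    rw [this]
    push_cast
    ring
  · intro t h1 h2
    rcases le_or_gt t t₀ with h | h
    · rw [e1 t h]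
      exact hαU t h1 (h.trans ht₀T)
    · rw [e2 t h.le]
      refine hseg (himg ▸ ⟨_, ⟨?_, ?_⟩, rfl⟩)
      · linarith [hs₀.1]
      · linarith

/-- Within a ball contained in `U`, reachability passes between points along segments; the reachable
set is thus open and relatively closed. -/
lemma isArcReachable_of_isPreconnected {U : Set ℂ} (hU : IsOpen U) (hc : IsPreconnected U)
    (h0 : (0 : ℂ) ∉ U) {p : ℂ} (hpU : p ∈ U) (hp : IsArcReachable U p) {y : ℂ} (hy : y ∈ U) :
    IsArcReachable U y := by
  have hball : ∀ z ∈ U, ∃ r > 0, Metric.ball z r ⊆ U := Metric.isOpen_iff.1 hU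
  have hopen : IsOpen {z | z ∈ U ∧ IsArcReachable U z} := by
    rw [Metric.isOpen_iff]
    rintro z ⟨hz, hz'⟩
    obtain ⟨r, hr, hrU⟩ := hball z hz
    refine ⟨r, hr, fun w hw => ⟨hrU hw, hz'.of_segment h0 ?_⟩⟩
    exact ((convex_ball z r).segment_subset (Metric.mem_ball_self hr) hw).trans hrU
  refine (hc.subset_of_closure_inter_subset hopen ⟨p, hpU, hpU, hp⟩ ?_ hy).2
  rintro z ⟨hz, hzU⟩
  refine ⟨hzU, ?_⟩
  obtain ⟨r, hr, hrU⟩ := hball z hzU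
  obtain ⟨w, ⟨-, hw⟩, hwz⟩ := Metric.mem_closure_iff.1 hz r hr
  refine hw.of_segment h0 ?_
  refine ((convex_ball z r).segment_subset ?_ (Metric.mem_ball_self hr)).trans hrU
  rwa [Metric.mem_ball, dist_comm]

/-- An arc from `0` to the foot of the vertical ray is left at its first point on the ray, which
then leads to `∞`. -/
lemma exists_isJordanCurveZeroInfty {U : Set ℂ} (hU : IsOpen U) (hc : IsPreconnected U)
    (him : ∀ z ∈ U, 0 < z.im) {R : ℝ} (hray : ∀ s : ℝ, R ≤ s → s * Complex.I ∈ U)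
    {p : ℂ} (hpU : p ∈ U) (hp : IsArcReachable U p) :
    ∃ γ : ℝ → ℂ, IsJordanCurveZeroInfty γ ∧ ∀ t : ℝ, 0 < t → γ t ∈ U := by
  have h0 : (0 : ℂ) ∉ U := fun h => by simpa using him 0 h
  obtain ⟨T, hT, α, hα, hinj, hα0, hαT, hαU⟩ :=
    isArcReachable_of_isPreconnected hU hc h0 hpU hp (hray R le_rfl)
  have hrayU : ∀ s : ℝ, 0 ≤ s → R * Complex.I + s * Complex.I ∈ U := fun s hs => by
    have := hray (R + s) (by linarith)
    rwa [Complex.ofReal_add, add_mul] at this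
  have hcl : IsClosed ((fun s : ℝ => R * Complex.I + s * Complex.I) '' Ici 0) := by
    have : (fun s : ℝ => R * Complex.I + s * Complex.I) '' Ici 0 =
        {z : ℂ | z.re = 0 ∧ R ≤ z.im} := by
      ext z
      constructor
      · rintro ⟨s, hs, rfl⟩
        simpa using hs
      · rintro ⟨h1, h2⟩
        refine ⟨z.im - R, by simpa using h2, ?_⟩
        apply Complex.ext <;> simp [h1]
    rw [this]
    exact (isClosed_eq Complex.continuous_re continuous_const).inter
      (isClosed_le continuous_const Complex.continuous_im)
  obtain ⟨t₀, s₀, ht₀, ht₀T, hs₀, γ, hγ, e1, e2, hγinj⟩ :=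
    exists_arc_concat_line hT hα hinj Complex.I_ne_zero hcl self_mem_Ici hαT (by
      rintro ⟨s, hs, h⟩
      exact h0 (hα0 ▸ h ▸ hrayU s hs))
  have hs₀' : 0 ≤ s₀ := hs₀
  have hγU : ∀ t : ℝ, 0 < t → γ t ∈ U := by
    intro t ht
    rcases le_or_gt t t₀ with h | h
    · rw [e1 t h]
      exact hαU t ht (h.trans ht₀T)
    · rw [e2 t h.le]
      exact hrayU _ (by linarith)
  have hγ0 : γ 0 = 0 := by rw [e1 0 ht₀.le, hα0]
  have hγinj' : InjOn γ (Ici 0) := by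
    refine hγinj.mono ?_
    intro t ht
    refine ⟨ht, ?_⟩
    rcases le_or_gt t t₀ with h | h
    · exact Or.inl h
    · refine Or.inr ?_
      rw [mem_Ici]
      linarith
  refine ⟨γ, ⟨hγ, hγinj', hγ0, ?_, fun t ht => ?_⟩, hγU⟩
  · rw [← Metric.cobounded_eq_cocompact, ← tendsto_norm_atTop_iff_cobounded]
    refine tendsto_atTop_mono' atTop (f₁ := fun t => R + (s₀ + (t - t₀))) ?_ ?_
    · filter_upwards [eventually_ge_atTop t₀] with t ht
      rw [e2 t ht, ← add_mul, norm_mul, Complex.norm_I, mul_one, ← Complex.ofReal_add,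
        Complex.norm_real]
      exact le_abs_self _
    · refine tendsto_atTop_add_const_left _ _ (tendsto_atTop_add_const_left _ _ ?_)
      exact tendsto_atTop_add_const_right _ (-t₀) tendsto_id
  · rcases ht.eq_or_lt with h | h
    · rw [← h, hγ0, Complex.zero_im]
    · exact (him _ (hγU t h)).le

end FreeProb

/-! ### Local charts, and an arc into the pole -/

namespace FreeProb

open Filter Topology Set
open scoped ComplexConjugate

/-- A local chart at `z₀` whose `k`-th power is `(z - z₀) ^ k * h z`, see `rootChart_pow`. -/
noncomputable def rootChart (z₀ : ℂ) (h : ℂ → ℂ) (k : ℕ) (z : ℂ) : ℂ :=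
  (z - z₀) * h z ^ ((k : ℂ)⁻¹)

lemma rootChart_pow (z₀ : ℂ) (h : ℂ → ℂ) {k : ℕ} (hk : k ≠ 0) (z : ℂ) :
    rootChart z₀ h k z ^ k = (z - z₀) ^ k * h z := by
  rw [rootChart, mul_pow, Complex.cpow_nat_inv_pow _ hk]

lemma rootChart_self (z₀ : ℂ) (h : ℂ → ℂ) (k : ℕ) : rootChart z₀ h k z₀ = 0 := by
  simp [rootChart]

lemma hasStrictDerivAt_rootChart {z₀ : ℂ} {h : ℂ → ℂ} (hh : AnalyticAt ℂ h z₀) (h1 : h z₀ = 1)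
    (k : ℕ) : HasStrictDerivAt (rootChart z₀ h k) 1 z₀ := by
  have hg : AnalyticAt ℂ (fun z => h z ^ ((k : ℂ)⁻¹)) z₀ :=
    hh.cpow analyticAt_const (by rw [h1]; exact Complex.one_mem_slitPlane)
  have hf : AnalyticAt ℂ (rootChart z₀ h k) z₀ := (analyticAt_id.sub analyticAt_const).mul hg
  have hd := ((hasDerivAt_id z₀).sub_const z₀).mul hg.differentiableAt.hasDerivAt
  have h2 := hf.hasStrictDerivAt
  have h3 : deriv (rootChart z₀ h k) z₀ = 1 := by
    refine (HasDerivAt.deriv (f := rootChart z₀ h k) hd).trans ?_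
    simp [h1]
  rwa [h3] at h2

variable {κ : ℕ → ℝ} {m : ℕ}

/-- In the chart `f` at `0` the map `K` becomes `c ζ ^ (-k)`. From a point of `Omega` near `0`,
shrinking `ζ` by `t` multiplies `K` by `t ^ (-k) > 0`, so `Im K` stays positive. The chart commutes
with conjugation, which keeps the arc off the real line. -/
lemma exists_isArcReachable (hκ : ∀ n : ℕ, m + 1 ≤ n → κ n = 0)
    (hφ : ∃ n : ℕ, 2 ≤ n ∧ κ n ≠ 0) (h0 : (0 : ℂ) ∈ closure (Omega κ m)) :
    ∃ p ∈ Omega κ m, IsArcReachable (Omega κ m) p := by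
  obtain ⟨k, c, q, hk, hc, hq, hK⟩ := exists_pole hκ hφ
  have hk0 : k ≠ 0 := by omega
  set h : ℂ → ℂ := fun z => (Polynomial.aeval z q)⁻¹ with hh
  have hq0 : Polynomial.aeval (0 : ℂ) q = 1 := by
    have := Polynomial.aeval_algebraMap_apply ℂ (0 : ℝ) q
    simpa [hq] using this
  have hh0 : h 0 = 1 := by simp [hh, hq0]
  have hqconj : ∀ z : ℂ, Polynomial.aeval (conj z) q = conj (Polynomial.aeval z q) :=
    fun z => Polynomial.aeval_conj q z
  have hhan : AnalyticAt ℂ h 0 := by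
    refine AnalyticAt.inv ?_ (by rw [hq0]; exact one_ne_zero)
    have : Differentiable ℂ fun z : ℂ => Polynomial.aeval z q := q.differentiable_aeval
    exact this.analyticAt 0
  set f := rootChart 0 h k with hf
  have hstrict : HasStrictDerivAt f 1 0 := hasStrictDerivAt_rootChart hhan hh0 k
  have hf0 : f 0 = 0 := rootChart_self 0 h k
  -- Positivity of the real part keeps `h z` off the branch cut, where the principal root does not
  -- commute with conjugation.
  have hfconj : ∀ z : ℂ, 0 < (h z).re → f (conj z) = conj (f z) := by
    intro z hz
    have harg : (h z).arg ≠ Real.pi := fun hcon =>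
      absurd (Complex.arg_eq_pi_iff.1 hcon).1 hz.le.not_gt
    have h1 : h (conj z) = conj (h z) := by simp only [hh, hqconj, map_inv₀]
    have h2 : conj (h z) ^ ((k : ℂ)⁻¹) = conj (h z ^ ((k : ℂ)⁻¹)) := by
      have h3 := Complex.conj_cpow (h z) ((k : ℂ)⁻¹) harg
      rwa [show conj ((k : ℂ)⁻¹) = (k : ℂ)⁻¹ by simp] at h3
    simp only [hf, rootChart, sub_zero, map_mul, h1, h2]
  have hKf : ∀ z : ℂ, z ≠ 0 → kmap κ m z = c * (f z ^ k)⁻¹ := by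
    intro z hz
    rw [hK z hz, hf, rootChart_pow _ _ hk0, sub_zero, hh, mul_inv, inv_inv]
    field_simp
  have hstrict' : HasStrictFDerivAt f
      (ContinuousLinearEquiv.unitsEquivAut ℂ (Units.mk0 (1 : ℂ) one_ne_zero) : ℂ →L[ℂ] ℂ) 0 :=
    hstrict.hasStrictFDerivAt_equiv one_ne_zero
  set e := hstrict'.toOpenPartialHomeomorph f with he
  have hecoe : ∀ z, e z = f z := fun _ => rfl
  have h0src : (0 : ℂ) ∈ e.source := hstrict'.mem_toOpenPartialHomeomorph_source
  have h0tgt : (0 : ℂ) ∈ e.target := by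
    have := e.map_source h0src
    rwa [hecoe, hf0] at this
  have hes0 : e.symm 0 = 0 := by
    have := e.left_inv h0src
    rwa [hecoe, hf0] at this
  have hcont : ContinuousAt h 0 := hhan.continuousAt
  have hre : ∀ᶠ z in 𝓝 (0 : ℂ), 0 < (h z).re := by
    have : ContinuousAt (fun z => (h z).re) 0 := Complex.continuous_re.continuousAt.comp hcont
    exact this.eventually (lt_mem_nhds (by simp [hh0]))
  obtain ⟨r, hr, hball⟩ := Metric.mem_nhds_iff.1
    ((e.open_source.eventually_mem h0src).and hre)
  have hsymm : ContinuousAt e.symm 0 := e.symm.continuousAt h0tgt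
  have hsymm' : ∀ᶠ ζ in 𝓝 (0 : ℂ), e.symm ζ ∈ Metric.ball (0 : ℂ) r := by
    refine hsymm.eventually (Metric.isOpen_ball.mem_nhds ?_)
    rw [hes0]
    exact Metric.mem_ball_self hr
  obtain ⟨δ, hδ, hδball⟩ := Metric.mem_nhds_iff.1
    ((e.open_target.eventually_mem h0tgt).and hsymm')
  have hfcont : ContinuousAt f 0 := hstrict.hasDerivAt.continuousAt
  have hfδ : ∀ᶠ z in 𝓝 (0 : ℂ), f z ∈ Metric.ball (0 : ℂ) δ := by
    refine hfcont.eventually (Metric.isOpen_ball.mem_nhds ?_)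
    rw [hf0]
    exact Metric.mem_ball_self hδ
  obtain ⟨z₀, ⟨hz₀f, hz₀r⟩, hz₀Ω⟩ := mem_closure_iff_nhds.1 h0 _
    (hfδ.and (Metric.ball_mem_nhds (0 : ℂ) hr))
  replace hz₀r : z₀ ∈ Metric.ball (0 : ℂ) r := hz₀r
  set ζ₀ := f z₀ with hζ₀
  have hz₀im : 0 < z₀.im := hz₀Ω.1.1
  have hmem : ∀ t : ℝ, 0 ≤ t → t ≤ 1 → (t : ℂ) * ζ₀ ∈ Metric.ball (0 : ℂ) δ := by
    intro t ht0 ht1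
    rw [mem_ball_zero_iff] at hz₀f ⊢
    rw [norm_mul, Complex.norm_real, Real.norm_eq_abs, abs_of_nonneg ht0]
    nlinarith [norm_nonneg ζ₀]
  set α : ℝ → ℂ := fun t => e.symm (t * ζ₀) with hα
  have hfα : ∀ t : ℝ, 0 ≤ t → t ≤ 1 → f (α t) = t * ζ₀ := fun t ht0 ht1 =>
    e.right_inv (hδball (hmem t ht0 ht1)).1
  have hαball : ∀ t : ℝ, 0 ≤ t → t ≤ 1 → α t ∈ Metric.ball (0 : ℂ) r := fun t ht0 ht1 =>
    (hδball (hmem t ht0 ht1)).2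
  have hα0 : α 0 = 0 := by simp [hα, hes0]
  have hα1 : α 1 = z₀ := by
    simp only [hα, Complex.ofReal_one, one_mul]
    exact e.left_inv (hball hz₀r).1
  -- If `ζ₀` were real, `z₀` and its conjugate would have the same image under the injective chart.
  have hζ₀ne : ζ₀.im ≠ 0 := by
    intro hcon
    have h1 : f (conj z₀) = f z₀ := by
      rw [hfconj z₀ (hball hz₀r).2, Complex.conj_eq_iff_im.2 hcon]
    have h2 : conj z₀ ∈ Metric.ball (0 : ℂ) r := by
      rw [mem_ball_zero_iff] at hz₀r ⊢
      simpa using hz₀r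
    have h3 : conj z₀ = z₀ := e.injOn (hball h2).1 (hball hz₀r).1 h1
    exact hz₀im.ne' (Complex.conj_eq_iff_im.1 h3)
  have hζ₀0 : ζ₀ ≠ 0 := fun h => hζ₀ne (by simp [h])
  have hαcont : ContinuousOn α (Icc 0 1) := by
    refine e.symm.continuousOn.comp (by fun_prop) fun t ht => ?_
    exact (hδball (hmem t ht.1 ht.2)).1
  have hαinj : InjOn α (Icc 0 1) := by
    intro t ht u hu heq
    have h1 := hfα t ht.1 ht.2
    rw [heq, hfα u hu.1 hu.2] at h1
    exact_mod_cast (mul_right_cancel₀ hζ₀0 h1).symm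
  -- A real point of the arc would have the real image `t ζ₀`. By the intermediate value theorem `Im
  -- α` then keeps the sign it has at `z₀`.
  have hαim : ∀ t : ℝ, 0 < t → t ≤ 1 → (α t).im ≠ 0 := by
    intro t ht0 ht1 hcon
    have h1 := hfconj (α t) (hball (hαball t ht0.le ht1)).2
    rw [Complex.conj_eq_iff_im.2 hcon, hfα t ht0.le ht1] at h1
    have h2 := Complex.conj_eq_iff_im.1 h1.symm
    rw [Complex.im_ofReal_mul] at h2
    exact (mul_ne_zero ht0.ne' hζ₀ne) h2
  have hαpos : ∀ t : ℝ, 0 < t → t ≤ 1 → 0 < (α t).im := by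
    intro t ht0 ht1
    by_contra hcon
    have hc1 : ContinuousOn (fun s => (α s).im) (Icc t 1) :=
      Complex.continuous_im.comp_continuousOn (hαcont.mono (Icc_subset_Icc_left ht0.le))
    obtain ⟨s, hs, hs0⟩ := intermediate_value_Icc ht1 hc1
      (⟨not_lt.1 hcon, by rw [hα1]; exact hz₀im.le⟩ : (0 : ℝ) ∈ Icc _ _)
    exact hαim s (ht0.trans_le hs.1) hs.2 hs0
  have hΩ : α '' Ioc 0 1 ⊆ Omega κ m := by
    refine subset_Omega_of_isPreconnected
      (isPreconnected_Ioc.image _ (hαcont.mono Ioc_subset_Icc_self)) ?_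
      ⟨z₀, ⟨1, ⟨one_pos, le_rfl⟩, hα1⟩, hz₀Ω⟩
    rintro _ ⟨t, ⟨ht0, ht1⟩, rfl⟩
    refine ⟨hαpos t ht0 ht1, ?_⟩
    change 0 < (kmap κ m (α t)).im
    have h1 : kmap κ m (α t) = ((t ^ k)⁻¹ : ℝ) * kmap κ m z₀ := by
      rw [hKf _ (ne_zero_of_im_pos (hαpos t ht0 ht1)), hKf _ (ne_zero_of_im_pos hz₀im),
        hfα t ht0.le ht1, ← hζ₀]
      push_cast
      rw [mul_pow, mul_inv]
      ring
    rw [h1, Complex.im_ofReal_mul]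
    exact mul_pos (by positivity) hz₀Ω.1.2
  exact ⟨z₀, hz₀Ω, 1, one_pos, α, hαcont, hαinj, hα0, hα1,
    fun t ht0 ht1 => hΩ ⟨t, ⟨ht0, ht1⟩, rfl⟩⟩

lemma zero_notMem_closure_Omega (hκ : ∀ n : ℕ, m + 1 ≤ n → κ n = 0)
    (hφ : ∃ n : ℕ, 2 ≤ n ∧ κ n ≠ 0)
    (h : ∀ γ : ℝ → ℂ, IsJordanCurveZeroInfty γ → ∃ t : ℝ, 0 < t ∧ γ t ∈ frontier (Omega κ m)) :
    (0 : ℂ) ∉ closure (Omega κ m) := by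
  intro h0
  obtain ⟨p, hp, hp'⟩ := exists_isArcReachable hκ hφ h0
  obtain ⟨R, -, hR1, -, -, -, hU⟩ := exists_Omega_eq κ m
  obtain ⟨γ, hγ, hγΩ⟩ := exists_isJordanCurveZeroInfty (isOpen_Omega κ m)
    (isPreconnected_Omega κ m) (fun z hz => hz.1.1) (R := R + 1) (fun s hs => hU ⟨by
      have : 0 < s := by linarith
      simpa using this, by
      rw [norm_mul, Complex.norm_I, mul_one, Complex.norm_real, Real.norm_eq_abs,
        abs_of_pos (by linarith)]
      linarith⟩) hp hp'
  obtain ⟨t, ht, hfr⟩ := h γ hγ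
  rw [(isOpen_Omega κ m).frontier_eq] at hfr
  exact hfr.2 (hγΩ t ht)

end FreeProb

/-! ### Bijectivity of z + φ(z) on Ω when 0 is not in its closure -/

namespace FreeProb

open Filter Topology Set

variable {κ : ℕ → ℝ} {m : ℕ}

lemma exists_le_norm_of_mem_Omega (h0 : (0 : ℂ) ∉ closure (Omega κ m)) :
    ∃ δ : ℝ, 0 < δ ∧ ∀ z ∈ Omega κ m, δ ≤ ‖z‖ := by
  rw [Metric.mem_closure_iff] at h0
  push Not at h0
  obtain ⟨δ, hδ, h⟩ := h0
  exact ⟨δ, hδ, fun z hz => by simpa using h z hz⟩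

lemma exists_norm_phi_le_of_mem_Omega (h0 : (0 : ℂ) ∉ closure (Omega κ m)) :
    ∃ C : ℝ, 0 < C ∧ ∀ z ∈ Omega κ m, ‖phi κ m z‖ ≤ C := by
  obtain ⟨δ, hδ, h⟩ := exists_le_norm_of_mem_Omega h0
  obtain ⟨C, hC, h'⟩ := exists_norm_phi_le κ m hδ
  exact ⟨C, hC, fun z hz => h' z (h z hz)⟩

/-- If `0` is not in the closure of `Omega`, then `z + φ(z)` is a proper map from `Omega` to the
upper half-plane. -/
lemma exists_tendsto_of_kmap_tendsto (h0 : (0 : ℂ) ∉ closure (Omega κ m)) {u : ℕ → ℂ}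
    (hu : ∀ n, u n ∈ Omega κ m) {w : ℂ} (hw : 0 < w.im)
    (hlim : Tendsto (fun n => kmap κ m (u n)) atTop (𝓝 w)) :
    ∃ z ∈ Omega κ m, kmap κ m z = w ∧ ∃ ψ : ℕ → ℕ, StrictMono ψ ∧
      Tendsto (u ∘ ψ) atTop (𝓝 z) := by
  obtain ⟨C, hC, hφ⟩ := exists_norm_phi_le_of_mem_Omega h0
  obtain ⟨B, hB⟩ := (Metric.isBounded_range_of_tendsto _ hlim).exists_norm_le
  -- `u = K(u) - φ(u)`, and both terms are bounded.
  have hbdd : ∀ n, u n ∈ Metric.closedBall (0 : ℂ) (B + C) := fun n => by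
    rw [mem_closedBall_zero_iff]
    have h1 := hB _ ⟨n, rfl⟩
    have h2 := hφ _ (hu n)
    have h3 : u n = kmap κ m (u n) - phi κ m (u n) := by simp [kmap]
    rw [h3]
    exact (norm_sub_le _ _).trans (add_le_add h1 h2)
  obtain ⟨z, -, ψ, hψ, hz⟩ := (isCompact_closedBall (0 : ℂ) (B + C)).tendsto_subseq hbdd
  have hzcl : z ∈ closure (Omega κ m) := mem_closure_of_tendsto hz (Eventually.of_forall
    fun n => hu (ψ n))
  have hz0 : z ≠ 0 := fun h => h0 (h ▸ hzcl)
  have hKz : kmap κ m z = w :=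
    tendsto_nhds_unique ((continuousAt_kmap κ m hz0).tendsto.comp hz)
      (hlim.comp hψ.tendsto_atTop)
  have him : 0 ≤ z.im := by
    refine ge_of_tendsto ((Complex.continuous_im.tendsto z).comp hz) (Eventually.of_forall
      fun n => ?_)
    exact (hu (ψ n)).1.1.le
  -- The limit is not real, since `K` is real on the real line and `w` is not.
  have him' : 0 < z.im := him.lt_of_ne' fun h => by
    have := kmap_im_eq_zero κ m h
    rw [hKz] at this
    exact hw.ne' this
  exact ⟨z, mem_Omega_of_mem_closure hzcl ⟨him', by
    change 0 < (kmap κ m z).im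
    rwa [hKz]⟩, hKz, ψ, hψ, hz⟩

lemma analyticOnNhd_kmap_Omega (κ : ℕ → ℝ) (m : ℕ) : AnalyticOnNhd ℂ (kmap κ m) (Omega κ m) :=
  fun _ hz => analyticAt_kmap κ m (ne_zero_of_im_pos hz.1.1)

/-- `Omega` contains points of arbitrarily large modulus. -/
lemma exists_mem_Omega_norm_gt (κ : ℕ → ℝ) (m : ℕ) (S : ℝ) : ∃ z ∈ Omega κ m, S < ‖z‖ := by
  obtain ⟨R, -, hR1, -, -, -, hU⟩ := exists_Omega_eq κ m
  have hpos : 0 < max R S + 1 := by linarith [le_max_left R S]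
  have hn : ‖((max R S + 1 : ℝ) : ℂ) * Complex.I‖ = max R S + 1 := by
    rw [norm_mul, Complex.norm_I, mul_one, Complex.norm_real, Real.norm_eq_abs, abs_of_pos hpos]
  refine ⟨((max R S + 1 : ℝ) : ℂ) * Complex.I, hU ⟨by simpa using hpos, ?_⟩, ?_⟩
  · rw [hn]
    linarith [le_max_left R S]
  · rw [hn]
    linarith [le_max_right R S]

/-- If `K` were locally constant, then `ζ = c - φ(ζ)` would hold throughout `Omega`, which is
unbounded, whereas `φ` is bounded there. -/
lemma not_eventually_kmap_eq (h0 : (0 : ℂ) ∉ closure (Omega κ m)) {z : ℂ}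
    (hz : z ∈ Omega κ m) (c : ℂ) : ¬ ∀ᶠ ζ in 𝓝 z, kmap κ m ζ = c := by
  intro h
  have heq := (analyticOnNhd_kmap_Omega κ m).eqOn_of_preconnected_of_eventuallyEq
    (analyticOnNhd_const (v := c)) (isPreconnected_Omega κ m) hz h
  obtain ⟨C, hC, hφ⟩ := exists_norm_phi_le_of_mem_Omega h0
  obtain ⟨ζ, hζ, hn⟩ := exists_mem_Omega_norm_gt κ m (‖c‖ + C)
  have h1 : ζ = c - phi κ m ζ := by
    have h2 : ζ + phi κ m ζ = c := heq hζ
    linear_combination h2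
  have h2 := norm_sub_le c (phi κ m ζ)
  rw [← h1] at h2
  linarith [hφ ζ hζ]

lemma nhds_le_map_kmap (h0 : (0 : ℂ) ∉ closure (Omega κ m)) {z : ℂ} (hz : z ∈ Omega κ m) :
    𝓝 (kmap κ m z) ≤ map (kmap κ m) (𝓝 z) :=
  ((analyticOnNhd_kmap_Omega κ m z hz).eventually_constant_or_nhds_le_map_nhds_aux).resolve_left
    (not_eventually_kmap_eq h0 hz _)

/-- The image of `Omega` is open by the open mapping theorem and relatively closed in the half-plane
by properness. -/
lemma im_pos_subset_image_kmap (h0 : (0 : ℂ) ∉ closure (Omega κ m)) :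
    {w : ℂ | 0 < w.im} ⊆ kmap κ m '' Omega κ m := by
  have hopen : IsOpen (kmap κ m '' Omega κ m) := by
    rw [isOpen_iff_mem_nhds]
    rintro _ ⟨z, hz, rfl⟩
    exact nhds_le_map_kmap h0 hz (image_mem_map ((isOpen_Omega κ m).mem_nhds hz))
  obtain ⟨z, hz⟩ := Omega_nonempty κ m
  refine isPreconnected_im_pos.subset_of_closure_inter_subset hopen ⟨_, hz.1.2, z, hz, rfl⟩ ?_
  rintro w ⟨hw, him⟩
  obtain ⟨v, hv, hvlim⟩ := mem_closure_iff_seq_limit.1 hw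
  choose u hu huv using hv
  obtain ⟨z, hz, hzw, -⟩ := exists_tendsto_of_kmap_tendsto h0 hu him
    (by simpa only [huv] using hvlim)
  exact ⟨z, hz, hzw⟩

/-- The points with exactly one preimage in `Omega`, which is not a critical point. -/
def simpleValues (κ : ℕ → ℝ) (m : ℕ) : Set ℂ :=
  {w | ∃ z ∈ Omega κ m, kmap κ m z = w ∧ deriv (kmap κ m) z ≠ 0 ∧
    ∀ z' ∈ Omega κ m, kmap κ m z' = w → z' = z}

lemma hasStrictDerivAt_kmap {z : ℂ} (hz : z ∈ Omega κ m) :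
    HasStrictDerivAt (kmap κ m) (deriv (kmap κ m) z) z :=
  (analyticOnNhd_kmap_Omega κ m z hz).hasStrictDerivAt

/-- The local inverse supplies one noncritical preimage. Second preimages of values tending to `K z`
would, by properness and uniqueness, accumulate at `z`, where `K` is injective. -/
lemma isOpen_simpleValues (h0 : (0 : ℂ) ∉ closure (Omega κ m)) : IsOpen (simpleValues κ m) := by
  rw [isOpen_iff_mem_nhds]
  rintro _ ⟨z, hz, rfl, hd, huniq⟩
  have hs := hasStrictDerivAt_kmap hz
  set g := hs.localInverse _ _ _ hd with hg
  have hleft : ∀ᶠ ζ in 𝓝 z, g (kmap κ m ζ) = ζ := hs.eventually_left_inverse hd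
  have hright : ∀ᶠ w in 𝓝 (kmap κ m z), kmap κ m (g w) = w := hs.eventually_right_inverse hd
  have hgz : g (kmap κ m z) = z := hleft.self_of_nhds
  have hgcont : Tendsto g (𝓝 (kmap κ m z)) (𝓝 z) := by
    have := (hs.to_localInverse hd).hasDerivAt.continuousAt.tendsto
    rwa [← hg, hgz] at this
  have hgΩ := hgcont.eventually ((isOpen_Omega κ m).eventually_mem hz)
  have hgd : ∀ᶠ w in 𝓝 (kmap κ m z), deriv (kmap κ m) (g w) ≠ 0 :=
    hgcont.eventually ((analyticOnNhd_kmap_Omega κ m z hz).deriv.continuousAt.eventually_ne hd)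
  by_contra hcon
  have hfreq : ∃ᶠ w in 𝓝 (kmap κ m z), w ∉ simpleValues κ m := fun h => hcon (by
    filter_upwards [h] with w hw using not_not.1 hw)
  have hfreq' : ∃ᶠ w in 𝓝 (kmap κ m z),
      ∃ ζ ∈ Omega κ m, kmap κ m ζ = w ∧ ζ ≠ g w := by
    refine (hfreq.and_eventually (hright.and (hgΩ.and hgd))).mono ?_
    rintro w ⟨h1, h2, h3, h4⟩
    by_contra! h5
    exact h1 ⟨g w, h3, h2, h4, h5⟩
  obtain ⟨v, hv, hv'⟩ := exists_seq_forall_of_frequently hfreq'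
  choose u hu huv hne using hv'
  obtain ⟨ζ, hζ, hζz, ψ, hψ, hlim⟩ := exists_tendsto_of_kmap_tendsto (w := kmap κ m z) h0 hu hz.1.2
    (by simpa only [huv] using hv)
  rw [huniq ζ hζ hζz] at hlim
  obtain ⟨n, hn⟩ := (hlim.eventually hleft).exists
  simp only [Function.comp, huv] at hn
  exact hne _ hn.symm

/-- A holomorphic function is not injective near a critical point: in each neighbourhood `V` of
`z`, values close to the critical value, and different from it, are taken twice. -/
lemma exists_ne_of_deriv_eq_zero {f : ℂ → ℂ} {z : ℂ} (hf : AnalyticAt ℂ f z)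
    (hne : ¬ ∀ᶠ ζ in 𝓝 z, f ζ = f z) (hd : deriv f z = 0) {V : Set ℂ} (hV : V ∈ 𝓝 z) :
    ∀ᶠ w in 𝓝 (f z), w ≠ f z → ∃ a ∈ V, ∃ b ∈ V, a ≠ b ∧ f a = w ∧ f b = w := by
  have hf' : AnalyticAt ℂ (fun ζ => f ζ - f z) z := hf.sub analyticAt_const
  obtain ⟨d, g, hg, hgz, hfg⟩ := hf'.exists_eventuallyEq_pow_smul_nonzero_iff.2
    (by simpa only [sub_eq_zero] using hne)
  simp only [smul_eq_mul] at hfg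
  have hd0 : d ≠ 0 := by
    rintro rfl
    have := hfg.self_of_nhds
    simp only [sub_self, pow_zero, one_mul] at this
    exact hgz this.symm
  have hd1 : d ≠ 1 := by
    rintro rfl
    have h1 : HasDerivAt (fun ζ => (ζ - z) ^ 1 * g ζ) (g z) z := by
      simpa using ((hasDerivAt_id z).sub_const z).fun_mul hg.differentiableAt.hasDerivAt
    have h2 : HasDerivAt (fun ζ => f ζ - f z) (g z) z := h1.congr_of_eventuallyEq hfg
    have h3 := (hf.differentiableAt.hasDerivAt.sub_const (f z)).unique h2
    rw [hd] at h3
    exact hgz h3.symm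
  set h : ℂ → ℂ := fun ζ => g ζ / g z with hh
  have hhan : AnalyticAt ℂ h z := hg.div analyticAt_const hgz
  -- Dividing by `g z` normalises `h`, so the chart `F` exists and `f - f z` becomes `g z * η ^ d`,
  -- with `d ≥ 2` because the derivative vanishes.
  have hhz : h z = 1 := div_self hgz
  set F := rootChart z h d with hF
  have hs : HasStrictFDerivAt F
      (ContinuousLinearEquiv.unitsEquivAut ℂ (Units.mk0 (1 : ℂ) one_ne_zero) : ℂ →L[ℂ] ℂ) z :=
    (hasStrictDerivAt_rootChart hhan hhz d).hasStrictFDerivAt_equiv one_ne_zero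
  set e := hs.toOpenPartialHomeomorph F with he
  have hzsrc : z ∈ e.source := hs.mem_toOpenPartialHomeomorph_source
  have hez : e z = 0 := rootChart_self z h d
  have h0tgt : (0 : ℂ) ∈ e.target := hez ▸ e.map_source hzsrc
  have hes0 : e.symm 0 = z := by rw [← hez, e.left_inv hzsrc]
  have hsymm : Tendsto e.symm (𝓝 0) (𝓝 z) := by
    have := (e.symm.continuousAt h0tgt).tendsto
    rwa [hes0] at this
  have hgood : ∀ᶠ η in 𝓝 (0 : ℂ), η ∈ e.target ∧ e.symm η ∈ V ∧
      f (e.symm η) - f z = g z * η ^ d := by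
    filter_upwards [e.open_target.eventually_mem h0tgt, hsymm.eventually hV,
      hsymm.eventually hfg] with η h1 h2 h3
    refine ⟨h1, h2, ?_⟩
    have h4 : F (e.symm η) = η := e.right_inv h1
    have h5 := rootChart_pow z h hd0 (e.symm η)
    rw [← hF, h4] at h5
    rw [h3, h5, hh]
    field_simp
  obtain ⟨ε, hε, hball⟩ := Metric.mem_nhds_iff.1 hgood
  have hr : 0 < ‖g z‖ * ε ^ d := mul_pos (norm_pos_iff.2 hgz) (pow_pos hε d)
  filter_upwards [Metric.ball_mem_nhds (f z) hr] with w hw hwne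
  obtain ⟨η, hη⟩ := IsAlgClosed.exists_pow_nat_eq ((w - f z) / g z) (Nat.pos_of_ne_zero hd0)
  have hw' : g z * η ^ d = w - f z := by
    rw [hη]
    field_simp
  have hηε : ‖η‖ < ε := by
    refine lt_of_pow_lt_pow_left₀ d hε.le ?_
    rw [mem_ball_iff_norm, ← hw', norm_mul, norm_pow] at hw
    exact lt_of_mul_lt_mul_left hw (norm_nonneg _)
  -- Two different preimages come from `η` and `ω η` with a primitive `d`-th root of unity `ω ≠ 1`.
  have hprim := Complex.isPrimitiveRoot_exp d hd0
  set ω := Complex.exp (2 * Real.pi * Complex.I / d) with hω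
  have hωd : ω ^ d = 1 := hprim.pow_eq_one
  have hω1 : ω ≠ 1 := fun h => by
    have := (hprim.pow_eq_one_iff_dvd 1).1 (by rw [pow_one, h])
    exact hd1 (Nat.dvd_one.1 this)
  have hωn : ‖ω‖ = 1 := hprim.norm'_eq_one hd0
  have hη0 : η ≠ 0 := by
    rintro rfl
    rw [zero_pow hd0, mul_zero] at hw'
    exact hwne (sub_eq_zero.1 hw'.symm)
  obtain ⟨a1, a2, a3⟩ := hball (mem_ball_zero_iff.2 hηε)
  obtain ⟨b1, b2, b3⟩ := hball (mem_ball_zero_iff.2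
    (show ‖ω * η‖ < ε by rwa [norm_mul, hωn, one_mul]))
  refine ⟨_, a2, _, b2, fun hab => ?_, ?_, ?_⟩
  · have h1 := e.symm.injOn a1 b1 hab
    have h2 : (ω - 1) * η = 0 := by linear_combination -h1
    exact (mul_ne_zero (sub_ne_zero.2 hω1) hη0) h2
  · rw [hw'] at a3
    linear_combination a3
  · rw [mul_pow, hωd, one_mul, hw'] at b3
    linear_combination b3

/-- If a value has two preimages, or a critical one, then all nearby values other than possibly
itself are taken twice, so it is not a limit of simple values. -/
lemma closure_simpleValues_inter_subset (h0 : (0 : ℂ) ∉ closure (Omega κ m)) :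
    closure (simpleValues κ m) ∩ {w : ℂ | 0 < w.im} ⊆ simpleValues κ m := by
  rintro w ⟨hw, him⟩
  obtain ⟨z, hz, rfl⟩ := im_pos_subset_image_kmap h0 him
  by_contra hcon
  have hfreq : ∃ᶠ w in 𝓝 (kmap κ m z), w ∈ simpleValues κ m :=
    mem_closure_iff_frequently.1 hw
  have huniq : ∀ z' ∈ Omega κ m, kmap κ m z' = kmap κ m z → z' = z := by
    intro z' hz' heq
    by_contra hne
    obtain ⟨V', V, hV'o, hVo, hz'V', hzV, hdisj⟩ := t2_separation hne
    have h1 : ∀ᶠ w in 𝓝 (kmap κ m z), w ∈ kmap κ m '' (V ∩ Omega κ m) :=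
      nhds_le_map_kmap h0 hz (image_mem_map
        ((hVo.inter (isOpen_Omega κ m)).mem_nhds ⟨hzV, hz⟩))
    have h2 : ∀ᶠ w in 𝓝 (kmap κ m z), w ∈ kmap κ m '' (V' ∩ Omega κ m) := by
      rw [← heq]
      exact nhds_le_map_kmap h0 hz' (image_mem_map
        ((hV'o.inter (isOpen_Omega κ m)).mem_nhds ⟨hz'V', hz'⟩))
    obtain ⟨_, ⟨p, -, -, -, hp⟩, ⟨a, ha, haw⟩, ⟨b, hb, hbw⟩⟩ :=
      (hfreq.and_eventually (h1.and h2)).exists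
    have hab : a = b := (hp a ha.2 haw).trans (hp b hb.2 hbw).symm
    exact disjoint_left.1 hdisj hb.1 (hab ▸ ha.1)
  have hd : deriv (kmap κ m) z = 0 := by
    by_contra hd
    exact hcon ⟨z, hz, rfl, hd, huniq⟩
  have hev := exists_ne_of_deriv_eq_zero (analyticOnNhd_kmap_Omega κ m z hz)
    (not_eventually_kmap_eq h0 hz _) hd ((isOpen_Omega κ m).mem_nhds hz)
  obtain ⟨w, hw1, hw2⟩ := (hfreq.and_eventually hev).exists
  obtain ⟨a, ha, b, hb, hab, haw, hbw⟩ := hw2 fun h => hcon (h ▸ hw1)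
  obtain ⟨p, -, -, -, hp⟩ := hw1
  exact hab ((hp a ha haw).trans (hp b hb hbw).symm)

lemma nonempty_im_pos_inter_simpleValues (h0 : (0 : ℂ) ∉ closure (Omega κ m)) :
    ({w : ℂ | 0 < w.im} ∩ simpleValues κ m).Nonempty := by
  obtain ⟨R, -, hR1, hR, -, -, -⟩ := exists_Omega_eq κ m
  obtain ⟨C, hC, hφ⟩ := exists_norm_phi_le_of_mem_Omega h0
  -- With `‖φ‖ ≤ C` on `Omega`, all preimages of `w` have modulus greater than `R`. There `φ` is a
  -- contraction with factor `1/2`, so `K` is injective and `K' ≠ 0`.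
  set w : ℂ := ((R + 1 + C : ℝ) : ℂ) * Complex.I with hw
  have hwim : 0 < w.im := by
    have : 0 < R + 1 + C := by linarith
    simpa [hw] using this
  have hwn : ‖w‖ = R + 1 + C := by
    rw [hw, norm_mul, Complex.norm_I, mul_one, Complex.norm_real, Real.norm_eq_abs,
      abs_of_pos (by linarith)]
  have hlarge : ∀ z ∈ Omega κ m, kmap κ m z = w → R < ‖z‖ := fun z hz hzw => by
    have h1 : w = z + phi κ m z := hzw.symm
    have h2 := norm_add_le z (phi κ m z)
    rw [← h1, hwn] at h2
    linarith [hφ z hz]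
  obtain ⟨z, hz, hzw⟩ := im_pos_subset_image_kmap h0 hwim
  refine ⟨w, hwim, z, hz, hzw, ?_, fun z' hz' hz'w => ?_⟩
  · have hzR := hlarge z hz hzw
    have hlip : LipschitzOnWith (1 / 2) (phi κ m) {ζ | R < ‖ζ‖} := by
      refine LipschitzOnWith.of_dist_le_mul fun a ha b hb => ?_
      rw [dist_eq_norm, dist_eq_norm]
      exact hR a b (le_of_lt ha) (le_of_lt hb)
    have hnhds : {ζ : ℂ | R < ‖ζ‖} ∈ 𝓝 z :=
      (isOpen_lt continuous_const continuous_norm).mem_nhds hzR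
    have h1 := norm_deriv_le_of_lipschitzOn hnhds hlip
    have h2 : deriv (kmap κ m) z = 1 + deriv (phi κ m) z :=
      ((hasDerivAt_id z).add
        (differentiableAt_phi κ m (ne_zero_of_im_pos hz.1.1)).hasDerivAt).deriv
    intro h3
    rw [h2] at h3
    have h4 : deriv (phi κ m) z = -1 := by linear_combination h3
    rw [h4, norm_neg, norm_one] at h1
    norm_num at h1
  · have h1 := hR z' z (hlarge z' hz' hz'w).le (hlarge z hz hzw).le
    have h2 : z' - z = -(phi κ m z' - phi κ m z) := by
      have : z' + phi κ m z' = z + phi κ m z := hz'w.trans hzw.symm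
      linear_combination this
    have h3 : ‖z' - z‖ = ‖phi κ m z' - phi κ m z‖ := by rw [h2, norm_neg]
    have h4 : ‖z' - z‖ ≤ 0 := by linarith
    exact sub_eq_zero.1 (norm_le_zero_iff.1 h4)

/-- If `0` is not in the closure of `Omega`, then `z + φ(z)` has a holomorphic right inverse on
the upper half-plane, with values in `Omega`. -/
lemma exists_right_inverse (h0 : (0 : ℂ) ∉ closure (Omega κ m)) :
    ∃ F : ℂ → ℂ, DifferentiableOn ℂ F {w | 0 < w.im} ∧
      ∀ w : ℂ, 0 < w.im → F w ∈ Omega κ m ∧ kmap κ m (F w) = w := by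
  have hall : {w : ℂ | 0 < w.im} ⊆ simpleValues κ m :=
    isPreconnected_im_pos.subset_of_closure_inter_subset (isOpen_simpleValues h0)
      (nonempty_im_pos_inter_simpleValues h0) (closure_simpleValues_inter_subset h0)
  have hex : ∀ w : ℂ, ∃ z, 0 < w.im → z ∈ Omega κ m ∧ kmap κ m z = w ∧
      deriv (kmap κ m) z ≠ 0 ∧ ∀ z' ∈ Omega κ m, kmap κ m z' = w → z' = z := by
    intro w
    by_cases hw : 0 < w.im
    · obtain ⟨z, hz⟩ := hall hw
      exact ⟨z, fun _ => hz⟩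
    · exact ⟨0, fun h => absurd h hw⟩
  choose F hF using hex
  refine ⟨F, fun w hw => ?_, fun w hw => ⟨(hF w hw).1, (hF w hw).2.1⟩⟩
  obtain ⟨hz, hKz, hd, -⟩ := hF w hw
  have hs := hasStrictDerivAt_kmap hz
  set g := hs.localInverse _ _ _ hd with hg
  have hgd : DifferentiableAt ℂ g w := by
    have := (hs.to_localInverse hd).hasDerivAt.differentiableAt
    rwa [hKz] at this
  have hright : ∀ᶠ v in 𝓝 w, kmap κ m (g v) = v := by
    have := hs.eventually_right_inverse hd
    rwa [hKz] at this
  have hgw : g w = F w := by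
    have : g (kmap κ m (F w)) = F w := (hs.eventually_left_inverse hd).self_of_nhds
    rwa [hKz] at this
  have hgΩ : ∀ᶠ v in 𝓝 w, g v ∈ Omega κ m := by
    refine hgd.continuousAt.eventually ((isOpen_Omega κ m).eventually_mem ?_)
    rwa [hgw]
  -- Uniqueness of preimages in `Omega` identifies `F` with the holomorphic local inverse.
  have hEq : F =ᶠ[𝓝 w] g := by
    filter_upwards [hright, hgΩ, isOpen_im_pos.eventually_mem hw] with v h1 h2 h3
    exact ((hF v h3).2.2.2 _ h2 h1).symm
  exact (hgd.congr_of_eventuallyEq hEq).differentiableWithinAt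

end FreeProb

/-! ### The Poisson formula for the upper half-plane -/

namespace FreeProb

open Filter Topology Set
open scoped ComplexConjugate

/-- The Poisson kernel of the upper half-plane (up to the factor `π`). -/
noncomputable def linePoisson (w : ℂ) (x : ℝ) : ℝ := w.im / ‖w - x‖ ^ 2

lemma linePoisson_eq (w : ℂ) (x : ℝ) :
    linePoisson w x = w.im⁻¹ * (1 + ((x - w.re) / w.im) ^ 2)⁻¹ := by
  rcases eq_or_ne w.im 0 with h | h
  · simp [linePoisson, h]
  · have h1 : ‖w - x‖ ^ 2 = (x - w.re) ^ 2 + w.im ^ 2 := by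
      rw [Complex.sq_norm, Complex.normSq_apply]
      simp only [Complex.sub_re, Complex.ofReal_re, Complex.sub_im, Complex.ofReal_im, sub_zero]
      ring
    have h2 : (x - w.re) ^ 2 + w.im ^ 2 ≠ 0 := by positivity
    have h3 : 1 + ((x - w.re) / w.im) ^ 2 ≠ 0 := by positivity
    rw [linePoisson, h1]
    field_simp
    ring

lemma integrable_linePoisson (w : ℂ) (hw : 0 < w.im) : Integrable (linePoisson w) := by
  have h := ((integrable_inv_one_add_sq.comp_div hw.ne').comp_sub_right w.re).const_mul w.im⁻¹
  exact h.congr (Eventually.of_forall fun x => (linePoisson_eq w x).symm)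

lemma integral_linePoisson (w : ℂ) (hw : 0 < w.im) : ∫ x, linePoisson w x = Real.pi := by
  simp only [linePoisson_eq]
  rw [integral_const_mul, integral_sub_right_eq_self (fun x => (1 + (x / w.im) ^ 2)⁻¹) w.re,
    Measure.integral_comp_div (fun x => (1 + x ^ 2)⁻¹) w.im, integral_univ_inv_one_add_sq,
    abs_of_pos hw, smul_eq_mul, inv_mul_cancel_left₀ hw.ne']

lemma linePoisson_nonneg {w : ℂ} (hw : 0 < w.im) (x : ℝ) : 0 ≤ linePoisson w x := by
  unfold linePoisson
  positivity

lemma continuous_linePoisson {w : ℂ} (hw : 0 < w.im) : Continuous (linePoisson w) := by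
  unfold linePoisson
  refine continuous_const.div (by fun_prop) fun x => ?_
  exact pow_ne_zero _ (norm_ne_zero_iff.2 (sub_ofReal_ne_zero hw.ne' x))

lemma linePoisson_le {w : ℂ} (hw : 0 < w.im) (x : ℝ) : linePoisson w x ≤ w.im⁻¹ := by
  rw [linePoisson_eq]
  refine mul_le_of_le_one_right (inv_nonneg.2 hw.le) (inv_le_one_of_one_le₀ ?_)
  have := sq_nonneg ((x - w.re) / w.im)
  linarith

/-- The integral over the real line of a function that is holomorphic near the closed upper
half-plane and decays quadratically vanishes. -/
lemma integral_eq_zero_of_quadratic_decay {Φ : ℂ → ℂ}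
    (hd : ∀ z : ℂ, 0 ≤ z.im → DifferentiableAt ℂ Φ z) {B S : ℝ}
    (hb : ∀ z : ℂ, 0 ≤ z.im → S ≤ ‖z‖ → ‖Φ z‖ ≤ B / ‖z‖ ^ 2)
    (hB : 0 ≤ B) (hint : Integrable fun x : ℝ => Φ x) : ∫ x : ℝ, Φ x = 0 := by
  have h1 : Tendsto (fun T : ℝ => ∫ x : ℝ in (-T)..T, Φ x) atTop (𝓝 (∫ x : ℝ, Φ x)) :=
    intervalIntegral_tendsto_integral hint tendsto_neg_atTop_atBot tendsto_id
  -- Cauchy's theorem on the rectangle `[-T, T] × [0, T]`: the three other sides have total length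
  -- `4T`, and the integrand is at most `B / T ^ 2` on them.
  refine tendsto_nhds_unique h1 (squeeze_zero_norm' (a := fun T => 4 * B / T) ?_ ?_)
  · filter_upwards [eventually_ge_atTop S, eventually_gt_atTop 0] with T hTS hT0
    have hrect := Complex.integral_boundary_rect_eq_zero_of_differentiableOn Φ
      (⟨-T, 0⟩ : ℂ) (⟨T, T⟩ : ℂ) (fun z hz => by
        refine (hd z ?_).differentiableWithinAt
        have h2 : z.im ∈ Set.uIcc 0 T := hz.2
        rw [uIcc_of_le hT0.le] at h2
        exact h2.1)
    simp only [Complex.ofReal_zero, zero_mul, add_zero] at hrect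
    have hbound : ∀ z : ℂ, 0 ≤ z.im → T ≤ ‖z‖ → ‖Φ z‖ ≤ B / T ^ 2 := fun z h2 h3 =>
      (hb z h2 (hTS.trans h3)).trans (by gcongr)
    have htop : ‖∫ x : ℝ in (-T)..T, Φ (x + T * Complex.I)‖ ≤ B / T ^ 2 * |T - -T| := by
      refine intervalIntegral.norm_integral_le_of_norm_le_const fun x _ => hbound _ ?_ ?_
      · simpa using hT0.le
      · have := Complex.abs_im_le_norm ((x : ℂ) + T * Complex.I)
        simp only [Complex.add_im, Complex.ofReal_im, Complex.mul_im, Complex.ofReal_re,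
          Complex.I_im, mul_one, Complex.I_re, mul_zero, add_zero, zero_add, abs_of_pos hT0] at this
        exact this
    have hside : ∀ a : ℝ, |a| = T → ‖∫ y : ℝ in (0 : ℝ)..T, Φ (a + y * Complex.I)‖ ≤
        B / T ^ 2 * |T - 0| := by
      intro a ha
      refine intervalIntegral.norm_integral_le_of_norm_le_const fun y hy => hbound _ ?_ ?_
      · rw [uIoc_of_le hT0.le] at hy
        simpa using hy.1.le
      · have := Complex.abs_re_le_norm ((a : ℂ) + y * Complex.I)
        simp only [Complex.add_re, Complex.ofReal_re, Complex.mul_re, Complex.ofReal_im,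
          Complex.I_re, mul_zero, Complex.I_im, zero_mul, sub_zero, add_zero, ha] at this
        exact this
    have hr := hside T (abs_of_pos hT0)
    have hl := hside (-T) (by rw [abs_neg, abs_of_pos hT0])
    have h4 : (∫ x : ℝ in (-T)..T, Φ x) = (∫ x : ℝ in (-T)..T, Φ (x + T * Complex.I)) -
        Complex.I • (∫ y : ℝ in (0 : ℝ)..T, Φ (T + y * Complex.I)) +
        Complex.I • (∫ y : ℝ in (0 : ℝ)..T, Φ ((-T : ℝ) + y * Complex.I)) := by
      linear_combination hrect
    rw [h4]
    refine (norm_add_le _ _).trans ((add_le_add_left (norm_sub_le _ _) _).trans ?_)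
    rw [norm_smul, norm_smul, Complex.norm_I, one_mul, one_mul]
    rw [show |T - -T| = 2 * T by rw [abs_of_pos] <;> linarith] at htop
    rw [sub_zero, abs_of_pos hT0] at hr hl
    have h5 : 4 * B / T = B / T ^ 2 * (2 * T) + B / T ^ 2 * T + B / T ^ 2 * T := by
      field_simp
      ring
    rw [h5]
    gcongr
  · exact tendsto_const_nhds.div_atTop tendsto_id

/-- The Poisson integral formula for bounded holomorphic functions. -/
lemma integral_linePoisson_mul {g : ℂ → ℂ} {ε B : ℝ} (hε : 0 < ε)
    (hg : DifferentiableOn ℂ g {z | -ε < z.im}) (hB : ∀ z : ℂ, 0 ≤ z.im → ‖g z‖ ≤ B)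
    {w : ℂ} (hw : 0 < w.im) :
    Integrable (fun x : ℝ => (linePoisson w x : ℂ) * g x) ∧
      ∫ x : ℝ, (linePoisson w x : ℂ) * g x = Real.pi * g w := by
  have hopen : IsOpen {z : ℂ | -ε < z.im} := isOpen_lt continuous_const Complex.continuous_im
  have hB0 : 0 ≤ B := (norm_nonneg _).trans (hB w hw.le)
  have hgcont : Continuous fun x : ℝ => g x := by
    rw [← continuousOn_univ]
    exact hg.continuousOn.comp Complex.continuous_ofReal.continuousOn fun x _ => by
      simpa using hε
  have hPC : Integrable fun x : ℝ => (linePoisson w x : ℂ) := (integrable_linePoisson w hw).ofReal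
  have hint : Integrable fun x : ℝ => (linePoisson w x : ℂ) * g x :=
    hPC.mul_bdd hgcont.aestronglyMeasurable
      (Eventually.of_forall fun x => hB x (by simp))
  refine ⟨hint, ?_⟩
  -- `Φ(z) = (g(z) - g(w)) / ((z - w)(z - conj w))` with its singularity at `w` removed; the other
  -- pole is in the lower half-plane. On the real line the denominator is `‖w - x‖ ^ 2`, which
  -- yields the Poisson kernel.
  set Φ : ℂ → ℂ := fun z => dslope g w z / (z - conj w) with hΦ
  have hne : ∀ z : ℂ, 0 ≤ z.im → z - conj w ≠ 0 := fun z hz h => by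
    have := congrArg Complex.im h
    simp only [Complex.sub_im, Complex.conj_im, Complex.zero_im] at this
    linarith
  have hds : DifferentiableOn ℂ (dslope g w) {z | -ε < z.im} :=
    (Complex.differentiableOn_dslope (hopen.mem_nhds (by
      change -ε < w.im
      linarith))).2 hg
  have hd : ∀ z : ℂ, 0 ≤ z.im → DifferentiableAt ℂ Φ z := fun z hz =>
    (hds.differentiableAt (hopen.mem_nhds (by
      change -ε < z.im
      linarith))).div (differentiableAt_id.sub_const _) (hne z hz)
  have hval : ∀ z : ℂ, z ≠ w → Φ z = (g z - g w) / ((z - w) * (z - conj w)) := fun z hz => by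
    rw [hΦ]
    simp only
    rw [dslope_of_ne _ hz, slope_def_field, div_div]
  have hreal : ∀ x : ℝ, Φ x =
      (w.im : ℂ)⁻¹ * ((linePoisson w x : ℂ) * g x - linePoisson w x * g w) := by
    intro x
    have hxw : (x : ℂ) ≠ w := fun h => by
      rw [← h, Complex.ofReal_im] at hw
      exact lt_irrefl _ hw
    have h1 : ((x : ℂ) - w) * (x - conj w) = ((‖w - x‖ ^ 2 : ℝ) : ℂ) := by
      have h2 : (x : ℂ) - conj w = conj ((x : ℂ) - w) := by simp
      rw [h2, Complex.mul_conj, Complex.normSq_eq_norm_sq, norm_sub_rev]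
    have him : (w.im : ℂ) ≠ 0 := by exact_mod_cast hw.ne'
    rw [hval _ hxw, h1, linePoisson]
    push_cast
    field_simp
  have hzero : ∫ x : ℝ, Φ x = 0 := by
    -- For `‖z‖ ≥ 2‖w‖ + 1` both factors of the denominator are at least `‖z‖ / 2` and the numerator
    -- is at most `2B`.
    refine integral_eq_zero_of_quadratic_decay hd (B := 8 * B) (S := 2 * ‖w‖ + 1) ?_
      (by positivity) ?_
    · intro z hz hS
      have hnw := norm_nonneg w
      have hzw : z ≠ w := by
        rintro rfl
        linarith
      have h1 : ‖z‖ / 2 ≤ ‖z - w‖ := by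
        have := norm_sub_norm_le z w
        linarith
      have h2 : ‖z‖ / 2 ≤ ‖z - conj w‖ := by
        have := norm_sub_norm_le z (conj w)
        rw [Complex.norm_conj] at this
        linarith
      have h3 : ‖g z - g w‖ ≤ 2 * B :=
        (norm_sub_le _ _).trans (by linarith [hB z hz, hB w hw.le])
      have h4 : 0 < ‖z‖ := by linarith
      rw [hval z hzw, norm_div, norm_mul]
      have h5 : 8 * B / ‖z‖ ^ 2 = 2 * B / (‖z‖ / 2 * (‖z‖ / 2)) := by
        field_simp
        ring
      rw [h5]
      gcongr
    · simp only [hreal]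
      exact (hint.sub (hPC.mul_const _)).const_mul _
  simp only [hreal] at hzero
  rw [integral_const_mul, integral_sub hint (hPC.mul_const _), integral_mul_const,
    integral_complex_ofReal, integral_linePoisson w hw] at hzero
  have him : (w.im : ℂ)⁻¹ ≠ 0 := inv_ne_zero (by exact_mod_cast hw.ne')
  exact sub_eq_zero.1 ((mul_eq_zero.1 hzero).resolve_left him)

end FreeProb

/-! ### Holomorphic functions as Cauchy transforms -/

namespace FreeProb

open Filter Topology Set

lemma exists_finiteMeasure_density {u : ℝ → ℝ} (hu : Continuous u) (h0 : ∀ x, 0 ≤ u x) {b : ℝ}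
    (hb : ∀ x, u x ≤ b) (R : ℝ) : ∃ ν : FiniteMeasure ℝ, ν.mass ≤ (2 * R * b).toNNReal ∧
      ν (Icc (-R) R)ᶜ = 0 ∧ ∀ f : ℝ → ℝ, ∫ x, f x ∂(ν : Measure ℝ) =
        ∫ x in Icc (-R) R, u x * f x := by
  set v : ℝ → NNReal := fun x => (u x).toNNReal with hv
  have hvm : Measurable v := hu.measurable.real_toNNReal
  set ρ : Measure ℝ := (volume.restrict (Icc (-R) R)).withDensity fun x => v x with hρ
  have hb0 : 0 ≤ b := (h0 0).trans (hb 0)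
  have hmass : ρ univ ≤ ((2 * R * b).toNNReal : ENNReal) := by
    rw [hρ, withDensity_apply _ MeasurableSet.univ, Measure.restrict_univ]
    calc ∫⁻ x in Icc (-R) R, (v x : ENNReal)
        ≤ ∫⁻ _ in Icc (-R) R, ENNReal.ofReal b :=
          lintegral_mono fun x => ENNReal.ofReal_le_ofReal (hb x)
      _ = ENNReal.ofReal (2 * R * b) := by
          rw [setLIntegral_const, Real.volume_Icc, mul_comm,
            ← ENNReal.ofReal_mul' hb0]
          congr 1
          ring
      _ = ((2 * R * b).toNNReal : ENNReal) := rfl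
  have : IsFiniteMeasure ρ := ⟨hmass.trans_lt ENNReal.coe_lt_top⟩
  obtain ⟨ν, hν⟩ : ∃ ν : FiniteMeasure ℝ, (ν : Measure ℝ) = ρ := ⟨⟨ρ, this⟩, rfl⟩
  refine ⟨ν, ?_, ?_, fun f => ?_⟩
  · rwa [← ENNReal.coe_le_coe, FiniteMeasure.ennreal_mass, hν]
  · rw [FiniteMeasure.null_iff_toMeasure_null, hν]
    refine withDensity_absolutelyContinuous _ _ ?_
    rw [Measure.restrict_apply measurableSet_Icc.compl, compl_inter_self, measure_empty]
  · rw [hν, hρ, integral_withDensity_eq_integral_smul hvm]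
    refine integral_congr_ae (Eventually.of_forall fun x => ?_)
    simp only [hv, NNReal.smul_def, smul_eq_mul, Real.coe_toNNReal _ (h0 x)]

lemma continuous_im_horizontal {G : ℂ → ℂ} (hG : DifferentiableOn ℂ G {w | 0 < w.im}) {ε : ℝ}
    (hε : 0 < ε) :
    Continuous fun x : ℝ => (G (x + ε * Complex.I)).im := by
  refine Complex.continuous_im.comp ?_
  rw [← continuousOn_univ]
  refine hG.continuousOn.comp (by fun_prop) fun x _ => ?_
  simpa using hε

/-- Shifting by `iε` makes `G` holomorphic across the real line, as the Poisson formula requires. -/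
lemma integral_linePoisson_mul_im {G : ℂ → ℂ} (hG : DifferentiableOn ℂ G {w | 0 < w.im}) {B : ℝ}
    (hB : ∀ w : ℂ, 0 < w.im → ‖G w‖ ≤ B) {ε : ℝ} (hε : 0 < ε) {w : ℂ} (hw : 0 < w.im) :
    Integrable (fun x : ℝ => linePoisson w x * (G (x + ε * Complex.I)).im) ∧
      ∫ x : ℝ, linePoisson w x * (G (x + ε * Complex.I)).im =
        Real.pi * (G (w + ε * Complex.I)).im := by
  have him : ∀ z : ℂ, (z + ε * Complex.I).im = z.im + ε := fun z => by simp
  obtain ⟨h1, h2⟩ := integral_linePoisson_mul (g := fun z => G (z + ε * Complex.I)) (B := B) hε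
    (hG.comp (differentiableOn_id.add_const _) fun z hz => by
      have hz' : -ε < z.im := hz
      change 0 < (z + ε * Complex.I).im
      rw [him]
      linarith)
    (fun z hz => hB _ (by rw [him]; linarith)) hw
  have h3 := h1.im
  have h4 := integral_im (𝕜 := ℂ) h1
  simp only [RCLike.im_to_complex, Complex.im_ofReal_mul] at h3 h4
  refine ⟨h3, ?_⟩
  rw [h4, h2, Complex.im_ofReal_mul]

/-- A bounded holomorphic function on the upper half-plane with non-positive imaginary part that
vanishes continuously on the boundary outside a compact interval, and behaves like `1 / w` at
infinity, is the Cauchy transform of a compactly supported probability measure. -/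
theorem exists_cauchyTransform_eq {G : ℂ → ℂ} (hG : DifferentiableOn ℂ G {w | 0 < w.im}) {B : ℝ}
    (hB : ∀ w : ℂ, 0 < w.im → ‖G w‖ ≤ B) (him : ∀ w : ℂ, 0 < w.im → (G w).im ≤ 0) {R D : ℝ}
    (hD0 : 0 ≤ D) (hD : ∀ w : ℂ, 0 < w.im → R < |w.re| → -(G w).im ≤ D * w.im)
    (hlim : Tendsto (fun y : ℝ => (y * Complex.I) * G (y * Complex.I)) atTop (𝓝 1)) :
    ∃ μ : Measure ℝ, IsProbabilityMeasure μ ∧ CompactlySupported μ ∧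
      ∀ w : ℂ, 0 < w.im → cauchyTransform μ w = G w := by
  have hpi := Real.pi_pos
  have himε : ∀ {ε : ℝ}, 0 < ε → ∀ x : ℝ, 0 < ((x : ℂ) + ε * Complex.I).im := fun hε x => by
    simpa using hε
  -- Stieltjes inversion: `ν ε` has density `-Im G(x + iε) / π`, cut off to `[-R, R]` so that mass
  -- and support are bounded uniformly in `ε`.
  have hex : ∀ ε : ℝ, ∃ ν : FiniteMeasure ℝ, 0 < ε →
      ν.mass ≤ (2 * R * (B / Real.pi)).toNNReal ∧ ν (Icc (-R) R)ᶜ = 0 ∧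
      ∀ f : ℝ → ℝ, ∫ x, f x ∂(ν : Measure ℝ) =
        ∫ x in Icc (-R) R, -(G (x + ε * Complex.I)).im / Real.pi * f x := by
    intro ε
    by_cases hε : 0 < ε
    · obtain ⟨ν, hν⟩ := exists_finiteMeasure_density
        (u := fun x : ℝ => -(G (x + ε * Complex.I)).im / Real.pi) (b := B / Real.pi)
        ((continuous_im_horizontal hG hε).neg.div_const _)
        (fun x => div_nonneg (neg_nonneg.2 (him _ (himε hε x))) hpi.le)
        (fun x => by
          have h1 := hB _ (himε hε x)
          have h2 := (abs_le.1 (Complex.abs_im_le_norm (G (x + ε * Complex.I)))).1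
          gcongr
          linarith) R
      exact ⟨ν, fun _ => hν⟩
    · exact ⟨0, fun h => absurd h hε⟩
  choose ν hν using hex
  have hpos : ∀ᶠ ε : ℝ in 𝓝[>] 0, 0 < ε := self_mem_nhdsWithin
  have hkey : ∀ w : ℂ, 0 < w.im → Tendsto (fun ε => ∫ x, linePoisson w x ∂(ν ε : Measure ℝ))
      (𝓝[>] 0) (𝓝 (-(G w).im)) := by
    intro w hw
    have hcont : Tendsto (fun ε : ℝ => -(G (w + ε * Complex.I)).im) (𝓝[>] 0)
        (𝓝 (-(G w).im)) := by
      have h1 : Tendsto (fun ε : ℝ => w + ε * Complex.I) (𝓝 0) (𝓝 w) := by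
        have : Continuous fun ε : ℝ => w + ε * Complex.I := by fun_prop
        simpa using this.tendsto 0
      have h2 : ContinuousAt G w := (hG.differentiableAt (isOpen_im_pos.mem_nhds hw)).continuousAt
      exact ((Complex.continuous_im.tendsto _).comp
        (h2.tendsto.comp (h1.mono_left nhdsWithin_le_nhds))).neg
    -- Without the cut-off the two terms would agree. Outside `[-R, R]` the density is at most `D ε
    -- / π`, and the kernel has integral `π`, so the error is at most `D ε`.
    have hdiff : Tendsto (fun ε : ℝ => (∫ x, linePoisson w x ∂(ν ε : Measure ℝ)) -
        -(G (w + ε * Complex.I)).im) (𝓝[>] 0) (𝓝 0) := by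
      refine squeeze_zero_norm' (a := fun ε => D * ε) ?_ ?_
      · filter_upwards [hpos] with ε hε
        obtain ⟨h1, h2⟩ := integral_linePoisson_mul_im hG hB hε hw
        set H : ℝ → ℝ := fun x => -(G (x + ε * Complex.I)).im / Real.pi * linePoisson w x with hH
        have hHeq : ∀ x, H x = -Real.pi⁻¹ * (linePoisson w x * (G (x + ε * Complex.I)).im) :=
          fun x => by
            rw [hH]
            ring
        have hHint : Integrable H :=
          (h1.const_mul (-Real.pi⁻¹)).congr (Eventually.of_forall fun x => (hHeq x).symm)
        have hHval : ∫ x, H x = -(G (w + ε * Complex.I)).im := by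
          simp only [hHeq]
          rw [integral_const_mul, h2]
          field_simp
        have hHnn : ∀ x, 0 ≤ H x := fun x => mul_nonneg
          (div_nonneg (neg_nonneg.2 (him _ (himε hε x))) hpi.le) (linePoisson_nonneg hw x)
        rw [(hν ε hε).2.2, ← hHval, ← integral_add_compl (s := Icc (-R) R) measurableSet_Icc hHint,
          sub_add_cancel_left, norm_neg, Real.norm_eq_abs,
          abs_of_nonneg (setIntegral_nonneg measurableSet_Icc.compl fun x _ => hHnn x)]
        have hPint := (integrable_linePoisson w hw).const_mul (D * ε / Real.pi)
        calc ∫ x in (Icc (-R) R)ᶜ, H x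
            ≤ ∫ x in (Icc (-R) R)ᶜ, D * ε / Real.pi * linePoisson w x := by
              refine setIntegral_mono_on hHint.integrableOn hPint.integrableOn
                measurableSet_Icc.compl fun x hx => ?_
              refine mul_le_mul_of_nonneg_right ?_ (linePoisson_nonneg hw x)
              have hxR : R < |x| := by
                by_contra hcon
                exact hx (abs_le.1 (not_lt.1 hcon))
              have h3 := hD _ (himε hε x) (by simpa using hxR)
              gcongr
              simpa using h3
          _ ≤ ∫ x, D * ε / Real.pi * linePoisson w x :=
              setIntegral_le_integral hPint (Eventually.of_forall fun x =>
                mul_nonneg (by positivity) (linePoisson_nonneg hw x))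
          _ = D * ε := by
              rw [integral_const_mul, integral_linePoisson w hw]
              field_simp
      · have : Continuous fun ε : ℝ => D * ε := by fun_prop
        simpa using (this.tendsto 0).mono_left nhdsWithin_le_nhds
    have := hdiff.add hcont
    simpa using this
  -- Along an ultrafilter `ε → 0`, weak compactness yields a limit of the measures `ν ε`.
  set U : Ultrafilter ℝ := Ultrafilter.of (𝓝[>] 0) with hU
  have hUle : (U : Filter ℝ) ≤ 𝓝[>] 0 := Ultrafilter.of_le _
  obtain ⟨ν₀, hν₀K, hν₀⟩ := (isCompact_setOfPred_finiteMeasure_le_of_isCompact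
      (2 * R * (B / Real.pi)).toNNReal (isCompact_Icc (a := -R) (b := R))).ultrafilter_le_nhds
    (U.map ν) (by
      rw [le_principal_iff]
      change ∀ᶠ ε in (U : Filter ℝ), ν ε ∈ _
      filter_upwards [hUle hpos] with ε hε
      exact ⟨(hν ε hε).1, (hν ε hε).2.1⟩)
  have hν₀lim : Tendsto ν U (𝓝 ν₀) := hν₀
  set μ : Measure ℝ := (ν₀ : Measure ℝ) with hμ
  have hsupp : μ (Icc (-R) R)ᶜ = 0 :=
    (FiniteMeasure.null_iff_toMeasure_null _ _).1 hν₀K.2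
  have hIm : ∀ w : ℂ, 0 < w.im → (cauchyTransform μ w).im = (G w).im := by
    intro w hw
    have h1 := FiniteMeasure.tendsto_iff_forall_integral_tendsto.1 hν₀lim
      (BoundedContinuousFunction.ofNormedAddCommGroup (linePoisson w) (continuous_linePoisson hw)
        w.im⁻¹ fun x => by
          rw [Real.norm_eq_abs, abs_of_nonneg (linePoisson_nonneg hw x)]
          exact linePoisson_le hw x)
    have h2 := tendsto_nhds_unique h1 ((hkey w hw).mono_left hUle)
    rw [cauchyTransform_im μ hw.ne']
    change -∫ x, linePoisson w x ∂μ = _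
    rw [neg_eq_iff_eq_neg]
    exact h2
  have hdiffμ : DifferentiableOn ℂ (cauchyTransform μ) {w | 0 < w.im} := fun w hw =>
    (differentiableAt_cauchyTransform μ (ne_of_gt hw)).differentiableWithinAt
  have hconn : IsConnected {w : ℂ | 0 < w.im} := ⟨⟨Complex.I, by simp⟩, isPreconnected_im_pos⟩
  -- Equal imaginary parts leave an additive constant `c`. Multiplying by `iy` and letting `y → ∞`
  -- gives finite limits on both sides, which forces `c = 0` and then total mass `1`.
  obtain ⟨c, hc⟩ := AnalyticOnNhd.eq_const_of_im_eq_const (c₀ := 0)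
    ((hG.sub hdiffμ).analyticOnNhd isOpen_im_pos)
    (fun w hw => by
      rw [Pi.sub_apply, Complex.sub_im, hIm w hw, sub_self]) isOpen_im_pos hconn
  have hyim : ∀ {y : ℝ}, 0 < y → 0 < ((y : ℂ) * Complex.I).im := fun hy => by simpa using hy
  have hlimμ : Tendsto (fun y : ℝ => (y * Complex.I) * cauchyTransform μ (y * Complex.I)) atTop
      (𝓝 ((μ.real univ : ℝ) : ℂ)) := by
    have h1 : ∀ y : ℝ, (y * Complex.I) * cauchyTransform μ (y * Complex.I) =
        ∫ x : ℝ, (y * Complex.I) * (y * Complex.I - x)⁻¹ ∂μ := fun y => by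
      rw [cauchyTransform, integral_const_mul]
    have h2 : ((μ.real univ : ℝ) : ℂ) = ∫ _ : ℝ, (1 : ℂ) ∂μ := by simp
    simp only [h1]
    rw [h2]
    refine tendsto_integral_filter_of_dominated_convergence (fun _ => 1) ?_ ?_
      (integrable_const _) (Eventually.of_forall fun x => ?_)
    · filter_upwards [eventually_gt_atTop 0] with y hy
      exact ((continuous_inv_sub_ofReal (hyim hy).ne').const_smul
        ((y : ℂ) * Complex.I)).aestronglyMeasurable
    · filter_upwards [eventually_gt_atTop 0] with y hy
      refine Eventually.of_forall fun x => ?_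
      have h3 := norm_inv_sub_ofReal_le (hyim hy).ne' x
      rw [norm_mul, norm_mul, Complex.norm_I, mul_one, Complex.norm_real, Real.norm_eq_abs,
        abs_of_pos hy]
      have h4 : |((y : ℂ) * Complex.I).im| = y := by simp [abs_of_pos hy]
      rw [h4] at h3
      calc y * ‖((y : ℂ) * Complex.I - x)⁻¹‖ ≤ y * y⁻¹ := by gcongr
        _ = 1 := mul_inv_cancel₀ hy.ne'
    · have h5 : Tendsto (fun y : ℝ => (1 : ℂ) - ((y⁻¹ : ℝ) : ℂ) * (x * (-Complex.I))) atTop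
          (𝓝 (1 - ((0 : ℝ) : ℂ) * (x * (-Complex.I)))) :=
        tendsto_const_nhds.sub
          (((Complex.continuous_ofReal.tendsto 0).comp tendsto_inv_atTop_zero).mul_const _)
      have h6 := h5.inv₀ (by simp)
      simp only [Complex.ofReal_zero, zero_mul, sub_zero, inv_one] at h6
      refine h6.congr' ?_
      filter_upwards [eventually_gt_atTop 0] with y hy
      have hy' : (y : ℂ) ≠ 0 := by exact_mod_cast hy.ne'
      have h7 : (y : ℂ) * Complex.I - x = (y * Complex.I) *
          (1 - ((y⁻¹ : ℝ) : ℂ) * (x * (-Complex.I))) := by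
        push_cast
        field_simp
        linear_combination (-(x : ℂ)) * Complex.I_sq
      rw [h7, mul_inv, mul_inv_cancel_left₀ (mul_ne_zero hy' Complex.I_ne_zero)]
  have hlimc : Tendsto (fun y : ℝ => ((y : ℂ) * Complex.I) * c) atTop
      (𝓝 (1 - ((μ.real univ : ℝ) : ℂ))) := by
    refine (hlim.sub hlimμ).congr' ?_
    filter_upwards [eventually_gt_atTop 0] with y hy
    rw [← hc _ (hyim hy), Pi.sub_apply]
    ring
  have hc0 : c = 0 := by
    by_contra hne
    have h1 : Tendsto (fun y : ℝ => ‖((y : ℂ) * Complex.I) * c‖) atTop atTop := by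
      have h2 : Tendsto (fun y : ℝ => y * ‖c‖) atTop atTop :=
        tendsto_id.atTop_mul_const (norm_pos_iff.2 hne)
      refine h2.congr' ?_
      filter_upwards [eventually_gt_atTop 0] with y hy
      rw [norm_mul, norm_mul, Complex.norm_I, mul_one, Complex.norm_real, Real.norm_eq_abs,
        abs_of_pos hy]
    exact not_tendsto_nhds_of_tendsto_atTop h1 _ hlimc.norm
  have hmass : μ.real univ = 1 := by
    rw [hc0] at hlimc
    simp only [mul_zero] at hlimc
    have h1 := tendsto_nhds_unique tendsto_const_nhds hlimc
    have h2 : ((μ.real univ : ℝ) : ℂ) = 1 := (sub_eq_zero.1 h1.symm).symm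
    exact_mod_cast h2
  refine ⟨μ, ⟨?_⟩, ⟨Icc (-R) R, isCompact_Icc, hsupp⟩, fun w hw => ?_⟩
  · rwa [measureReal_def, ENNReal.toReal_eq_one_iff] at hmass
  · have := hc w hw
    rw [hc0, Pi.sub_apply] at this
    exact (sub_eq_zero.1 this).symm

/-! ### The measure with the given free cumulants -/

variable {κ : ℕ → ℝ} {m : ℕ}

/-- The Cauchy transform sought is `1/F`, with `F` the right inverse of `K`; it is bounded because
`F` takes values in `Omega`, at distance at least `δ` from `0`. -/
theorem exists_measure_of_zero_notMem_closure (hκ : ∀ n : ℕ, m + 1 ≤ n → κ n = 0)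
    (h0 : (0 : ℂ) ∉ closure (Omega κ m)) :
    ∃ μ : Measure ℝ, IsProbabilityMeasure μ ∧ CompactlySupported μ ∧ IsFreeCumulantSeq μ κ := by
  obtain ⟨F, hFd, hF⟩ := exists_right_inverse h0
  obtain ⟨δ, hδ, hδΩ⟩ := exists_le_norm_of_mem_Omega h0
  obtain ⟨C, hC, hφ⟩ := exists_norm_phi_le_of_mem_Omega h0
  obtain ⟨R, -, hR1, hR, -, -, -⟩ := exists_Omega_eq κ m
  have hF0 : ∀ w : ℂ, 0 < w.im → F w ≠ 0 := fun w hw => ne_zero_of_im_pos (hF w hw).1.1.1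
  have hFeq : ∀ w : ℂ, 0 < w.im → w = F w + phi κ m (F w) := fun w hw => (hF w hw).2.symm
  have hGim : ∀ w : ℂ, ((F w)⁻¹).im = -((F w).im / ‖F w‖ ^ 2) := fun w => by
    rw [Complex.inv_im, Complex.normSq_eq_norm_sq, neg_div]
  obtain ⟨μ, hprob, hcomp, hμ⟩ := exists_cauchyTransform_eq (G := fun w => (F w)⁻¹)
    (B := δ⁻¹) (R := R + C) (D := 2)
    (hFd.inv hF0) (fun w hw => by
      rw [norm_inv]
      exact inv_anti₀ hδ (hδΩ _ (hF w hw).1))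
    (fun w hw => by
      rw [hGim]
      exact neg_nonpos.2 (div_nonneg (hF w hw).1.1.1.le (by positivity)))
    zero_le_two
    -- If `|Re w| > R + C`, then `‖F w‖ ≥ R ≥ 1`. There `|Im φ| ≤ Im F / 2`, hence `Im F ≤ 2 Im w`,
    -- which explains `D = 2`.
    (fun w hw hwR => by
      have h1 := Complex.abs_re_le_norm w
      have h2 : ‖w‖ ≤ ‖F w‖ + C := by
        calc ‖w‖ = ‖F w + phi κ m (F w)‖ := congrArg norm (hFeq w hw)
          _ ≤ ‖F w‖ + ‖phi κ m (F w)‖ := norm_add_le _ _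
          _ ≤ ‖F w‖ + C := by gcongr; exact hφ _ (hF w hw).1
      have h3 : R ≤ ‖F w‖ := by linarith
      have h4 := abs_im_phi_le hR h3
      have h5 : w.im = (F w).im + (phi κ m (F w)).im := by
        rw [← Complex.add_im, ← hFeq w hw]
      have h6 : 0 < (F w).im := (hF w hw).1.1.1
      rw [abs_of_pos h6] at h4
      have h7 := (abs_le.1 h4).1
      rw [hGim, neg_neg]
      have h8 : (F w).im / ‖F w‖ ^ 2 ≤ (F w).im :=
        div_le_self h6.le (one_le_pow₀ (hR1.trans h3))
      linarith)
    (by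
      -- With `w = iy`, `w - F(w) = φ(F(w))` is bounded by `C`, so `F(w) / w → 1`.
      have h1 : Tendsto (fun y : ℝ => (y * Complex.I - F (y * Complex.I)) * (y * Complex.I)⁻¹)
          atTop (𝓝 0) := by
        refine squeeze_zero_norm' (a := fun y => C * y⁻¹) ?_ ?_
        · filter_upwards [eventually_gt_atTop 0] with y hy
          have hyim : 0 < ((y : ℂ) * Complex.I).im := by simpa using hy
          have h2 : (y : ℂ) * Complex.I - F (y * Complex.I) = phi κ m (F (y * Complex.I)) := by
            linear_combination hFeq _ hyim
          rw [h2, norm_mul, norm_inv, norm_mul, Complex.norm_I, mul_one, Complex.norm_real,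
            Real.norm_eq_abs, abs_of_pos hy]
          gcongr
          exact hφ _ (hF _ hyim).1
        · simpa using tendsto_inv_atTop_zero.const_mul C
      have h3 := ((tendsto_const_nhds (x := (1 : ℂ))).sub h1).inv₀ (by simp)
      simp only [sub_zero, inv_one] at h3
      refine h3.congr' ?_
      filter_upwards [eventually_gt_atTop 0] with y hy
      have hyim : 0 < ((y : ℂ) * Complex.I).im := by simpa using hy
      have hy0 : (y : ℂ) * Complex.I ≠ 0 := ne_zero_of_im_pos hyim
      have h4 : 1 - (y * Complex.I - F (y * Complex.I)) * ((y : ℂ) * Complex.I)⁻¹ =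
          ((y : ℂ) * Complex.I)⁻¹ * F (y * Complex.I) := by
        rw [sub_mul, mul_inv_cancel₀ hy0]
        ring
      rw [h4, mul_inv, inv_inv])
  refine ⟨μ, hprob, hcomp, isFreeCumulantSeq_of_kmap hcomp hκ fun w hw => ?_⟩
  rw [hμ w hw, inv_inv]
  exact (hF w hw).2

end FreeProb

theorem theorem2 (κ : ℕ → ℝ) (m : ℕ) (hm : 2 ≤ m)
    (hκ : ∀ n : ℕ, m + 1 ≤ n → κ n = 0) (hφ : ∃ n : ℕ, 2 ≤ n ∧ κ n ≠ 0) :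
    (∃ μ : MeasureTheory.Measure ℝ, MeasureTheory.IsProbabilityMeasure μ ∧
        FreeProb.CompactlySupported μ ∧ FreeProb.IsFreeCumulantSeq μ κ) ↔
      ∀ γ : ℝ → ℂ, FreeProb.IsJordanCurveZeroInfty γ →
        ∃ t : ℝ, 0 < t ∧ γ t ∈ frontier (FreeProb.Omega κ m) := by
  constructor
  · rintro ⟨μ, hprob, hcomp, hcum⟩ γ hγ
    exact FreeProb.exists_mem_frontier_Omega hcomp hκ hφ hcum hγ
  · intro h
    exact FreeProb.exists_measure_of_zero_notMem_closure hκ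
      (FreeProb.zero_notMem_closure_Omega hκ hφ h)
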